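/- Let $K\ge 2$ bidders have i.i.d. values $X_1,\dots,X_K\ge 0$ with finite mean, with distribution function $F$ and with a density $f$ that is continuous and positive on an open interval $I\subseteq[0,\infty)$ (bounded or not) and zero elsewhere. Let $\varphi_X(x)=x-\frac{1-F(x)}{f(x)}$ be the virtual value and, for $x\in I$, let $$\beta^{I}(x)=E[Y\mid Y<x]=\frac{1}{F(x)^{K-1}}\int_{y<x} y\,(K-1)F(y)^{K-2}f(y)\,dy ,$$ where $Y$ is the maximum of $K-1$ independent copies of $X_1$. A shading function is a continuous, strictly increasing function $\gamma:I\to[0,\infty)$ with $E[\gamma(X_1)]<\infty$. If bidder $j$ shades by $\gamma_j$, she reports $\gamma_j(X_j)$, and the seller runs the Myerson auction for the laws of the reports $\gamma_j(X_j)$: bidder $i$ wins if the (ironed, where necessary) virtual value of her report is at least $Z_i$, the maximum of $0$ and of the (ironed) virtual values of the other reports; she then pays the lowest report of hers that would still have won. A bidder's payoff is the expectation of her value minus her payment on the event that she wins. (0) All bidding $\beta^{I}$ is a symmetric Nash equilibrium of the first-price auction without reserve price (among all measurable bidding functions), with integrable utilities. (1) If a shading function $g$ is differentiable on $I$ and satisfies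 $$g(x)+g'(x)\,(\varphi_X(x)-x)=\beta^{I}(x)\qquad (x\in I),$$ then all bidders shading by $g$ is a Nash equilibrium of the Myerson auction among all shading functions. In this equilibrium each bidder's utility is integrable, and her expected payoff equals her expected payoff in the first-price auction in which all bidders bid $\beta^{I}$. (2) The function $g(x)=E[\beta^{I}(X)\mid X\ge x]$, where $X$ has the law of $X_1$, is a shading function (in particular strictly increasing on $I$) that is differentiable on $I$ and satisfies this equation. The law of the reports $g(X_1)$ is regular: it has a positive density on the interior of its support, and its virtual value is strictly increasing there. -/

import Mathlib

open MeasureTheory ProbabilityTheory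

noncomputable section

namespace Auction

/-! ### The value distribution -/

/-- `f` is the density of a value distribution: a probability density, continuous and positive on
an open interval of nonnegative numbers (bounded or not), zero elsewhere, with finite mean. -/
structure IsValueDensity (f : ℝ → ℝ) : Prop where
  nonneg : ∀ x, 0 ≤ f x
  isOpen_support : IsOpen {x | 0 < f x}
  ordConnected_support : {x | 0 < f x}.OrdConnected
  support_nonneg : ∀ x, 0 < f x → 0 ≤ x
  continuousOn : ContinuousOn f {x | 0 < f x}
  integral_eq_one : ∫ x, f x = 1
  finite_mean : Integrable (fun x => x * f x)

/-- The law of a value with density `f`. -/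
def law (f : ℝ → ℝ) : Measure ℝ := volume.withDensity (fun x => ENNReal.ofReal (f x))

/-- The joint law of the independent values of `K` bidders. -/
def valuesLaw (K : ℕ) (f : ℝ → ℝ) : Measure (Fin K → ℝ) := Measure.pi (fun _ => law f)

/-! ### Virtual values, regularity and ironing -/

/-- The points at which the distribution function of `ν` is strictly between `0` and `1`. For a
law with a positive density on an interval, this is the interior of the support. -/
def core (ν : Measure ℝ) : Set ℝ := {y | 0 < cdf ν y ∧ cdf ν y < 1}

/-- The virtual value `y - (1 - F y) / F' y`, where `F` is the distribution function of `ν`. -/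
def virtualValue (ν : Measure ℝ) (y : ℝ) : ℝ := y - (1 - cdf ν y) / deriv (cdf ν) y

/-- A regular distribution: it has a positive density on its core, and an increasing virtual
value there. -/
def IsRegular (ν : Measure ℝ) : Prop :=
  (∀ y ∈ core ν, DifferentiableAt ℝ (cdf ν) y ∧ 0 < deriv (cdf ν) y) ∧
    StrictMonoOn (virtualValue ν) (core ν)

/-- The price at which the item is sold with probability `q` to a buyer with value law `ν`. -/
def quantilePrice (ν : Measure ℝ) (q : ℝ) : ℝ := sInf {y | 1 - q ≤ cdf ν y}

/-- The revenue curve in quantile space. Its slope at `q = 1 - F y` is the virtual value of `y`. -/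
def revenueCurve (ν : Measure ℝ) (q : ℝ) : ℝ := q * quantilePrice ν q

/-- The least concave majorant of the revenue curve on `(0, 1)`. -/
def ironedRevenueCurve (ν : Measure ℝ) (q : ℝ) : ℝ :=
  sInf {r | ∃ a b : ℝ, (∀ p ∈ Set.Ioo (0 : ℝ) 1, revenueCurve ν p ≤ a + b * p) ∧ r = a + b * q}

/-- The ironed virtual value: the (right) slope of the ironed revenue curve at `q = 1 - F y`. For a
regular distribution the revenue curve is concave and this is the virtual value on the core. -/
def ironedVirtualValue (ν : Measure ℝ) (y : ℝ) : ℝ :=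
  derivWithin (ironedRevenueCurve ν) (Set.Ioi (1 - cdf ν y)) (1 - cdf ν y)

/-! ### The Myerson auction played with shading functions -/

/-- Admissible shading functions for a bidder with value density `f`: continuous and increasing on
the value interval, with nonnegative reports of finite mean. -/
structure IsShading (f γ : ℝ → ℝ) : Prop where
  continuousOn : ContinuousOn γ {x | 0 < f x}
  strictMonoOn : StrictMonoOn γ {x | 0 < f x}
  nonneg : ∀ x, 0 < f x → 0 ≤ γ x
  integrable : Integrable γ (law f)

/-- The law of the reports of a bidder who shades by `γ`. The seller takes it for her value law. -/
def reportLaw (f γ : ℝ → ℝ) : Measure ℝ := (law f).map γ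

/-- The level `v` in virtual-value space meets the reserve `0` and the (ironed) virtual values of
all opponents of bidder `i`, when the seller believes in the laws `ν` and receives the reports `b`:
`v ≥ Z`, where `Z` is the maximum of `0` and of the virtual values of the opponents. -/
def Beats {K : ℕ} (ν : Fin K → Measure ℝ) (b : Fin K → ℝ) (i : Fin K) (v : ℝ) : Prop :=
  0 ≤ v ∧ ∀ j, j ≠ i → ironedVirtualValue (ν j) (b j) ≤ v

/-- What bidder `i` pays in the Myerson auction if she wins: the lowest report of hers with which
she would still have won. -/
def myersonPrice {K : ℕ} (ν : Fin K → Measure ℝ) (b : Fin K → ℝ) (i : Fin K) : ℝ :=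
  sInf {y | y ∈ core (ν i) ∧ Beats ν b i (ironedVirtualValue (ν i) y)}

/-- Bidder `i`'s utility in the Myerson auction, as a function of the values `x`, if each bidder
`j` shades by `s j` and the seller uses the resulting report laws. -/
def myersonUtility {K : ℕ} (f : ℝ → ℝ) (s : Fin K → ℝ → ℝ) (i : Fin K) : (Fin K → ℝ) → ℝ :=
  Set.indicator
    {x | Beats (fun j => reportLaw f (s j)) (fun j => s j (x j)) i
      (ironedVirtualValue (reportLaw f (s i)) (s i (x i)))}
    (fun x => x i - myersonPrice (fun j => reportLaw f (s j)) (fun j => s j (x j)) i)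

/-- Bidder `i`'s expected payoff in the Myerson auction. -/
def myersonPayoff {K : ℕ} (f : ℝ → ℝ) (s : Fin K → ℝ → ℝ) (i : Fin K) : ℝ :=
  ∫ x, myersonUtility f s i x ∂(valuesLaw K f)

/-- Nash equilibrium among shading functions in the Myerson auction. -/
def IsMyersonEquilibrium {K : ℕ} (f : ℝ → ℝ) (s : Fin K → ℝ → ℝ) : Prop :=
  ∀ i, IsShading f (s i) ∧
    ∀ γ, IsShading f γ → myersonPayoff f (Function.update s i γ) i ≤ myersonPayoff f s i

/-! ### The first-price auction -/

/-- Bidder `i`'s utility in the first-price auction without reserve price, as a function of the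
values `x`, if each bidder `j` uses the bidding function `b j`. -/
def firstPriceUtility {K : ℕ} (b : Fin K → ℝ → ℝ) (i : Fin K) : (Fin K → ℝ) → ℝ :=
  Set.indicator {x | ∀ j, j ≠ i → b j (x j) ≤ b i (x i)} (fun x => x i - b i (x i))

/-- Bidder `i`'s expected payoff in the first-price auction. -/
def firstPricePayoff {K : ℕ} (f : ℝ → ℝ) (b : Fin K → ℝ → ℝ) (i : Fin K) : ℝ :=
  ∫ x, firstPriceUtility b i x ∂(valuesLaw K f)

/-- Nash equilibrium among bidding functions in the first-price auction. (A deviation whose expected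
payment is infinite is credited with the payoff `0`, which only makes the condition stronger.) -/
def IsFirstPriceEquilibrium {K : ℕ} (f : ℝ → ℝ) (b : Fin K → ℝ → ℝ) : Prop :=
  ∀ i, ∀ c : ℝ → ℝ, Measurable c →
    firstPricePayoff f (Function.update b i c) i ≤ firstPricePayoff f b i

/-- The first-price bid `β(x) = E[Y | Y < x]`, where `Y` is the maximum of the values of the `K - 1`
opponents, whose distribution function is `F ^ (K - 1)`. -/
def firstPriceBid (K : ℕ) (f : ℝ → ℝ) (x : ℝ) : ℝ :=
  (∫ y in Set.Iio x, y * (((K - 1 : ℕ) : ℝ) * cdf (law f) y ^ (K - 2) * f y)) /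
    cdf (law f) x ^ (K - 1)

/-! ### The shading equation and its solution -/

/-- `g` is differentiable and `g x + g' x * (φ x - x) = β x` on the value interval, where `φ` is the
virtual value of the value law and `β` the first-price bid. -/
def SolvesShadingEquation (K : ℕ) (f g : ℝ → ℝ) : Prop :=
  ∀ x, 0 < f x → DifferentiableAt ℝ g x ∧
    g x + deriv g x * (virtualValue (law f) x - x) = firstPriceBid K f x

/-- `g x = E[β(X) | X ≥ x]`. -/
def equilibriumShading (K : ℕ) (f : ℝ → ℝ) (x : ℝ) : ℝ :=
  ∫ u, firstPriceBid K f u ∂(ProbabilityTheory.cond (law f) (Set.Ici x))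

end Auction

end

/-! Work in quantile space. A bidder who shades by `g` generates the revenue curve `R(1 - F x) = (1
- F x) * g x`. The shading equation says that `(1 - F) * g` and the tail integral `B x = ∫_{u > x} β
dF` have the same derivative; integrability of `g` makes both vanish at the top, so they agree and
`g = meanAbove f β`. Hence `R(1 - F x) = B x` has slope `β x` in the quantile. As `β` increases, `R`
is concave, and the virtual value of the report `g x` is the first-price bid `β x`
(`IsBid.ironedVirtualValue_eq`).

Consider a deviation `γ` with ironed virtual values `ψ`. It wins exactly when `ψ x ≥ β(Y)`, with `Y`
the strongest opponent's value. The threshold price times the winning probability is at least the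
integral of `ψ` over the winning values (`IsShading.integrableOn_winSet_and_le`): the line whose
slope is the winning level and which passes through the threshold point dominates the ironed revenue
curve. So `γ` earns no more than a first-price bidder who bids `ψ x`.

In the first-price auction, bidding `c` at value `x` wins against an initial segment of opponent
values on which the mean of `Y` is at most `c`. The payoff is therefore at most `E[(x - Y)⁺]`
(`IsValueDensity.sub_mul_le_expectedGain`), with equality at `c = β x`. This proves the first-price
equilibrium and bounds every Myerson deviation by the first-price equilibrium payoff.

That payoff is attained by `g`: given `Y = y`, the Myerson payment `g y * P(X ≥ y)` equals the
expected first-price payment `∫_{x ≥ y} β dF` (`integral_shadingDuelUtility`). -/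

namespace Auction

open Set Filter Topology

/-! ### Distribution functions of value densities -/

/-- The primitive of an integrable function has the integrand as derivative at points of
continuity. -/
theorem hasDerivAt_integral_Iic {φ : ℝ → ℝ} (hφ : Integrable φ) {x : ℝ} (hx : ContinuousAt φ x) :
    HasDerivAt (fun t => ∫ y in Iic t, φ y) (φ x) x := by
  have h : (fun t => ∫ y in Iic t, φ y) = fun t => (∫ y in Iic x, φ y) + ∫ y in x..t, φ y := by
    funext t
    rw [← intervalIntegral.integral_Iic_sub_Iic hφ.integrableOn hφ.integrableOn]
    ring
  rw [h]
  exact (intervalIntegral.integral_hasDerivAt_right (by simp)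
    hφ.aestronglyMeasurable.stronglyMeasurableAtFilter hx).const_add _

theorem continuous_integral_Iic {φ : ℝ → ℝ} (hφ : Integrable φ) :
    Continuous (fun t => ∫ y in Iic t, φ y) := by
  have h : (fun t => ∫ y in Iic t, φ y) = fun t => (∫ y in Iic 0, φ y) + ∫ y in 0..t, φ y := by
    funext t
    rw [← intervalIntegral.integral_Iic_sub_Iic hφ.integrableOn hφ.integrableOn]
    ring
  rw [h]
  exact continuous_const.add
    (intervalIntegral.continuous_primitive (fun a b => hφ.intervalIntegrable) 0)

instance (f : ℝ → ℝ) : NullSingletonClass (law f) := by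
  unfold law; infer_instance

namespace IsValueDensity

variable {f : ℝ → ℝ}

theorem integrable (hf : IsValueDensity f) : Integrable f := by
  by_contra h
  have := hf.integral_eq_one
  rw [integral_undef h] at this
  exact zero_ne_one this

theorem measurable (hf : IsValueDensity f) : Measurable f := by
  classical
  have h : f = piecewise {x | 0 < f x} f (fun _ => 0) := by
    funext x
    by_cases hx : 0 < f x
    · simp [piecewise, hx]
    · simp [piecewise, le_antisymm (not_lt.1 hx) (hf.nonneg x)]
  rw [h]
  exact hf.continuousOn.measurable_piecewise continuousOn_const hf.isOpen_support.measurableSet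

theorem measurableSet_support (hf : IsValueDensity f) : MeasurableSet {x | 0 < f x} :=
  hf.isOpen_support.measurableSet

theorem isProbabilityMeasure (hf : IsValueDensity f) : IsProbabilityMeasure (law f) := by
  constructor
  rw [law, withDensity_apply _ MeasurableSet.univ, Measure.restrict_univ,
    ← ofReal_integral_eq_lintegral_ofReal hf.integrable (ae_of_all _ hf.nonneg),
    hf.integral_eq_one, ENNReal.ofReal_one]

theorem setIntegral_law (hf : IsValueDensity f) (φ : ℝ → ℝ) {s : Set ℝ} (hs : MeasurableSet s) :
    ∫ x in s, φ x ∂law f = ∫ x in s, φ x * f x := by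
  rw [law, restrict_withDensity hs,
    integral_withDensity_eq_integral_toReal_smul hf.measurable.ennreal_ofReal
    (ae_of_all _ fun _ => ENNReal.ofReal_lt_top)]
  exact integral_congr_ae (ae_of_all _ fun x => by
    simp [ENNReal.toReal_ofReal (hf.nonneg x), mul_comm])

theorem integrable_law_iff (hf : IsValueDensity f) {φ : ℝ → ℝ} :
    Integrable φ (law f) ↔ Integrable (fun x => φ x * f x) := by
  rw [law, integrable_withDensity_iff hf.measurable.ennreal_ofReal
    (ae_of_all _ fun _ => ENNReal.ofReal_lt_top)]
  simp only [ENNReal.toReal_ofReal (hf.nonneg _)]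

theorem integrable_id_law (hf : IsValueDensity f) : Integrable (fun x => x) (law f) :=
  hf.integrable_law_iff.2 hf.finite_mean

theorem ae_pos (hf : IsValueDensity f) : ∀ᵐ x ∂law f, 0 < f x := by
  rw [law, ae_withDensity_iff hf.measurable.ennreal_ofReal]
  exact ae_of_all _ fun x hx => by simpa using hx

theorem restrict_support (hf : IsValueDensity f) : (law f).restrict {x | 0 < f x} = law f :=
  Measure.restrict_eq_self_of_ae_mem hf.ae_pos

theorem cdf_eq_real_Iic (hf : IsValueDensity f) (x : ℝ) :
    cdf (law f) x = (law f).real (Iic x) := by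
  have := hf.isProbabilityMeasure
  exact cdf_eq_real _ x

theorem cdf_eq_integral (hf : IsValueDensity f) (x : ℝ) :
    cdf (law f) x = ∫ y in Iic x, f y := by
  have := hf.isProbabilityMeasure
  rw [cdf_eq_real]
  have := hf.setIntegral_law (fun _ => 1) (measurableSet_Iic (a := x))
  simpa using this

theorem cdf_eq_real_Iio (hf : IsValueDensity f) (x : ℝ) :
    cdf (law f) x = (law f).real (Iio x) := by
  rw [hf.cdf_eq_real_Iic]
  exact measureReal_congr Iio_ae_eq_Iic.symm

theorem one_sub_cdf (hf : IsValueDensity f) (x : ℝ) :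
    1 - cdf (law f) x = (law f).real (Ici x) := by
  have := hf.isProbabilityMeasure
  rw [hf.cdf_eq_real_Iio, ← probReal_compl_eq_one_sub measurableSet_Iio, compl_Iio]

theorem one_sub_cdf' (hf : IsValueDensity f) (x : ℝ) :
    1 - cdf (law f) x = (law f).real (Ioi x) := by
  have := hf.isProbabilityMeasure
  rw [hf.cdf_eq_real_Iic, ← probReal_compl_eq_one_sub measurableSet_Iic, compl_Iic]

theorem continuousAt (hf : IsValueDensity f) {x : ℝ} (hx : 0 < f x) : ContinuousAt f x :=
  hf.continuousOn.continuousAt (hf.isOpen_support.mem_nhds hx)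

theorem hasDerivAt_cdf (hf : IsValueDensity f) {x : ℝ} (hx : 0 < f x) :
    HasDerivAt (cdf (law f)) (f x) x := by
  rw [show (cdf (law f) : ℝ → ℝ) = fun t => ∫ y in Iic t, f y from funext hf.cdf_eq_integral]
  exact hasDerivAt_integral_Iic hf.integrable (hf.continuousAt hx)

theorem continuous_cdf (hf : IsValueDensity f) : Continuous (cdf (law f)) := by
  rw [show (cdf (law f) : ℝ → ℝ) = fun t => ∫ y in Iic t, f y from funext hf.cdf_eq_integral]
  exact continuous_integral_Iic hf.integrable

theorem strictMonoOn_cdf (hf : IsValueDensity f) : StrictMonoOn (cdf (law f)) {x | 0 < f x} := by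
  apply strictMonoOn_of_deriv_pos hf.ordConnected_support.convex hf.continuous_cdf.continuousOn
  intro x hx
  have hx' : x ∈ {x | 0 < f x} := interior_subset hx
  rw [(hf.hasDerivAt_cdf hx').deriv]
  exact hx'

theorem exists_lt (hf : IsValueDensity f) {x : ℝ} (hx : 0 < f x) : ∃ y < x, 0 < f y := by
  obtain ⟨l, hl, h⟩ := exists_Ioc_subset_of_mem_nhds (hf.isOpen_support.mem_nhds hx) ⟨x - 1, by simp⟩
  obtain ⟨y, hy⟩ := exists_between hl
  exact ⟨y, hy.2, h ⟨hy.1, hy.2.le⟩⟩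

theorem exists_gt (hf : IsValueDensity f) {x : ℝ} (hx : 0 < f x) : ∃ y > x, 0 < f y := by
  obtain ⟨l, hl, h⟩ := exists_Ico_subset_of_mem_nhds (hf.isOpen_support.mem_nhds hx) ⟨x + 1, by simp⟩
  obtain ⟨y, hy⟩ := exists_between hl
  exact ⟨y, hy.1, h ⟨hy.1.le, hy.2⟩⟩

/-- The support of the density is the set where the distribution function is strictly between
`0` and `1`. -/
theorem pos_iff (hf : IsValueDensity f) {x : ℝ} :
    0 < f x ↔ 0 < cdf (law f) x ∧ cdf (law f) x < 1 := by
  constructor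
  · intro hx
    obtain ⟨y, hy, hy'⟩ := hf.exists_lt hx
    obtain ⟨z, hz, hz'⟩ := hf.exists_gt hx
    exact ⟨(cdf_nonneg _ y).trans_lt (hf.strictMonoOn_cdf hy' hx hy),
      (hf.strictMonoOn_cdf hx hz' hz).trans_le (cdf_le_one _ z)⟩
  · rintro ⟨h0, h1⟩
    have := hf.isProbabilityMeasure
    have hl : ∃ y ≤ x, 0 < f y := by
      by_contra! hcon
      have : (law f).real (Iic x) = 0 := by
        rw [measureReal_eq_zero_iff]
        refine measure_mono_null (fun y hy => ?_) hf.ae_pos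
        exact not_lt.2 (hcon y hy)
      rw [hf.cdf_eq_real_Iic, this] at h0
      exact lt_irrefl _ h0
    have hr : ∃ y ≥ x, 0 < f y := by
      by_contra! hcon
      have : (law f).real (Ici x) = 0 := by
        rw [measureReal_eq_zero_iff]
        refine measure_mono_null (fun y hy => ?_) hf.ae_pos
        exact not_lt.2 (hcon y hy)
      rw [← hf.one_sub_cdf] at this
      linarith
    obtain ⟨y, hy, hy'⟩ := hl
    obtain ⟨z, hz, hz'⟩ := hr
    exact hf.ordConnected_support.out hy' hz' ⟨hy, hz⟩

theorem cdf_pos (hf : IsValueDensity f) {x : ℝ} (hx : 0 < f x) : 0 < cdf (law f) x :=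
  (hf.pos_iff.1 hx).1

theorem cdf_lt_one (hf : IsValueDensity f) {x : ℝ} (hx : 0 < f x) : cdf (law f) x < 1 :=
  (hf.pos_iff.1 hx).2

theorem exists_cdf_eq (hf : IsValueDensity f) {q : ℝ} (h0 : 0 < q) (h1 : q < 1) :
    ∃ x, 0 < f x ∧ cdf (law f) x = q := by
  obtain ⟨x, hx⟩ := mem_range_of_exists_le_of_exists_ge hf.continuous_cdf
    ((tendsto_cdf_atBot (law f)).eventually (ge_mem_nhds h0)).exists
    ((tendsto_cdf_atTop (law f)).eventually (le_mem_nhds h1)).exists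
  exact ⟨x, hf.pos_iff.2 (by rw [hx]; exact ⟨h0, h1⟩), hx⟩

theorem cdf_lt_iff (hf : IsValueDensity f) {x y : ℝ} (hx : 0 < f x) (hy : 0 < f y) :
    cdf (law f) x < cdf (law f) y ↔ x < y := hf.strictMonoOn_cdf.lt_iff_lt hx hy

end IsValueDensity

/-! ### The law of the strongest opponent's value -/

/-- The density of the maximum of `m + 1` independent values with density `f`. -/
noncomputable def maxDensity (m : ℕ) (f : ℝ → ℝ) (x : ℝ) : ℝ :=
  ((m + 1 : ℕ) : ℝ) * cdf (law f) x ^ m * f x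

namespace IsValueDensity

variable {f : ℝ → ℝ}

theorem maxDensity_nonneg (hf : IsValueDensity f) (m : ℕ) (x : ℝ) : 0 ≤ maxDensity m f x :=
  mul_nonneg (mul_nonneg (Nat.cast_nonneg _) (pow_nonneg (cdf_nonneg _ _) _)) (hf.nonneg x)

theorem maxDensity_le (hf : IsValueDensity f) (m : ℕ) (x : ℝ) :
    maxDensity m f x ≤ ((m + 1 : ℕ) : ℝ) * f x :=
  mul_le_mul_of_nonneg_right
    (mul_le_of_le_one_right (Nat.cast_nonneg _) (pow_le_one₀ (cdf_nonneg _ _) (cdf_le_one _ _)))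
    (hf.nonneg x)

theorem maxDensity_pos_iff (hf : IsValueDensity f) (m : ℕ) {x : ℝ} :
    0 < maxDensity m f x ↔ 0 < f x := by
  constructor
  · intro h
    by_contra h'
    rw [maxDensity, le_antisymm (not_lt.1 h') (hf.nonneg x), mul_zero] at h
    exact lt_irrefl _ h
  · intro h
    exact mul_pos (mul_pos (by exact_mod_cast m.succ_pos) (pow_pos (hf.cdf_pos h) _)) h

theorem measurable_maxDensity (hf : IsValueDensity f) (m : ℕ) : Measurable (maxDensity m f) :=
  (measurable_const.mul (hf.continuous_cdf.measurable.pow_const m)).mul hf.measurable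

theorem integrable_maxDensity (hf : IsValueDensity f) (m : ℕ) : Integrable (maxDensity m f) := by
  refine (hf.integrable.const_mul ((m + 1 : ℕ) : ℝ)).mono'
    (hf.measurable_maxDensity m).aestronglyMeasurable (ae_of_all _ fun x => ?_)
  rw [Real.norm_of_nonneg (hf.maxDensity_nonneg m x)]
  exact hf.maxDensity_le m x

theorem integral_Iic_maxDensity_sub_le (hf : IsValueDensity f) (m : ℕ) {x y : ℝ} (hxy : x ≤ y) :
    (∫ u in Iic y, maxDensity m f u) - (∫ u in Iic x, maxDensity m f u) ≤
      ((m + 1 : ℕ) : ℝ) * (cdf (law f) y - cdf (law f) x) := by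
  rw [intervalIntegral.integral_Iic_sub_Iic (hf.integrable_maxDensity m).integrableOn
    (hf.integrable_maxDensity m).integrableOn, hf.cdf_eq_integral, hf.cdf_eq_integral,
    intervalIntegral.integral_Iic_sub_Iic hf.integrable.integrableOn hf.integrable.integrableOn,
    ← intervalIntegral.integral_const_mul]
  exact intervalIntegral.integral_mono_on hxy (hf.integrable_maxDensity m).intervalIntegrable
    (hf.integrable.const_mul _).intervalIntegrable fun u _ => hf.maxDensity_le m u

theorem integral_Iic_maxDensity_mono (hf : IsValueDensity f) (m : ℕ) :
    Monotone fun x => ∫ u in Iic x, maxDensity m f u := fun _ _ hxy =>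
  setIntegral_mono_set (hf.integrable_maxDensity m).integrableOn
    (ae_of_all _ fun u => hf.maxDensity_nonneg m u) (Iic_subset_Iic.2 hxy).eventuallyLE

theorem integral_Iic_maxDensity_le (hf : IsValueDensity f) (m : ℕ) (x : ℝ) :
    ∫ u in Iic x, maxDensity m f u ≤ ((m + 1 : ℕ) : ℝ) * cdf (law f) x := by
  rw [hf.cdf_eq_integral, ← integral_const_mul]
  exact setIntegral_mono (hf.integrable_maxDensity m).integrableOn
    (hf.integrable.const_mul _).integrableOn fun u => hf.maxDensity_le m u

theorem hasDerivAt_integral_Iic_maxDensity_sub (hf : IsValueDensity f) (m : ℕ) {x : ℝ}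
    (hx : 0 < f x) :
    HasDerivAt (fun t => (∫ u in Iic t, maxDensity m f u) - cdf (law f) t ^ (m + 1)) 0 x := by
  have h1 := hasDerivAt_integral_Iic (hf.integrable_maxDensity m) (x := x)
    ((continuousAt_const.mul (hf.continuous_cdf.continuousAt.pow m)).mul (hf.continuousAt hx))
  have h2 := (hf.hasDerivAt_cdf hx).pow (m + 1)
  refine (h1.sub h2).congr_deriv ?_
  simp [maxDensity]

/-- Both sides have the same derivative on the support, an interval, so they differ there by a
constant. At a point where `F = q` the difference is at most `(m + 2) * q`, and `q` can be taken
arbitrarily small. -/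
theorem integral_Iic_maxDensity_of_pos (hf : IsValueDensity f) (m : ℕ) {x : ℝ} (hx : 0 < f x) :
    ∫ u in Iic x, maxDensity m f u = cdf (law f) x ^ (m + 1) := by
  set G : ℝ → ℝ := fun t => (∫ u in Iic t, maxDensity m f u) - cdf (law f) t ^ (m + 1) with hG
  have hconst : ∀ {y}, 0 < f y → G x = G y := fun {y} hy =>
    hf.isOpen_support.is_const_of_deriv_eq_zero hf.ordConnected_support.isPreconnected
      (fun z hz => (hf.hasDerivAt_integral_Iic_maxDensity_sub m hz).differentiableAt.differentiableWithinAt)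
      (fun z hz => (hf.hasDerivAt_integral_Iic_maxDensity_sub m hz).deriv) hx hy
  have hbound : ∀ q ∈ Ioo (0 : ℝ) 1, |G x| ≤ ((m + 2 : ℕ) : ℝ) * q := by
    intro q hq
    obtain ⟨y, hy, hyq⟩ := hf.exists_cdf_eq hq.1 hq.2
    rw [hconst hy]
    have h1 := hf.integral_Iic_maxDensity_le m y
    have h2 : 0 ≤ ∫ u in Iic y, maxDensity m f u :=
      integral_nonneg fun u => hf.maxDensity_nonneg m u
    have h3 : q ^ (m + 1) ≤ q := pow_le_of_le_one hq.1.le hq.2.le (by simp)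
    have h4 : 0 ≤ q ^ (m + 1) := pow_nonneg hq.1.le _
    simp only [hG]
    rw [hyq] at h1 ⊢
    push_cast at h1 ⊢
    rw [abs_le]
    constructor <;> nlinarith [hq.1, mul_nonneg (Nat.cast_nonneg (α := ℝ) m) hq.1.le]
  have hz : |G x| ≤ 0 := by
    have ht : Tendsto (fun q : ℝ => ((m + 2 : ℕ) : ℝ) * q) (𝓝[>] 0) (𝓝 (((m + 2 : ℕ) : ℝ) * 0)) :=
      (tendsto_id.mono_left nhdsWithin_le_nhds).const_mul _
    rw [mul_zero] at ht
    exact ge_of_tendsto ht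
      (eventually_of_mem (Ioo_mem_nhdsGT one_pos) hbound)
  have := abs_nonpos_iff.1 hz
  simp only [hG] at this
  linarith

theorem integral_Iic_maxDensity (hf : IsValueDensity f) (m : ℕ) (x : ℝ) :
    ∫ u in Iic x, maxDensity m f u = cdf (law f) x ^ (m + 1) := by
  rcases (cdf_nonneg (law f) x).eq_or_lt with h0 | h0
  · refine le_antisymm ((hf.integral_Iic_maxDensity_le m x).trans ?_) ?_
    · simp [← h0]
    · rw [← h0]
      simpa using integral_nonneg fun u => hf.maxDensity_nonneg m u
  rcases (cdf_le_one (law f) x).lt_or_eq with h1 | h1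
  · exact hf.integral_Iic_maxDensity_of_pos m (hf.pos_iff.2 ⟨h0, h1⟩)
  -- Above the support, compare with a point where `F = q` and let `q` tend to `1`.
  have hq : ∀ q ∈ Ioo (0 : ℝ) 1, q ^ (m + 1) ≤ ∫ u in Iic x, maxDensity m f u ∧
      ∫ u in Iic x, maxDensity m f u ≤ q ^ (m + 1) + ((m + 1 : ℕ) : ℝ) * (1 - q) := by
    intro q hq
    obtain ⟨y, hy, hyq⟩ := hf.exists_cdf_eq hq.1 hq.2
    have hyx : y ≤ x := by
      by_contra! h
      have := monotone_cdf (law f) h.le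
      linarith [hq.2]
    have e1 := hf.integral_Iic_maxDensity_mono m hyx
    have e2 := hf.integral_Iic_maxDensity_sub_le m hyx
    simp only [hf.integral_Iic_maxDensity_of_pos m hy] at e1 e2
    rw [hyq] at e1 e2
    rw [h1] at e2
    exact ⟨e1, by linarith⟩
  have hmem : Ioo (0 : ℝ) 1 ∈ 𝓝[<] (1 : ℝ) := Ioo_mem_nhdsLT one_pos
  have c1 : Tendsto (fun q : ℝ => q ^ (m + 1)) (𝓝[<] 1) (𝓝 (1 ^ (m + 1))) :=
    ((continuous_pow _).tendsto _).mono_left nhdsWithin_le_nhds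
  have c2 : Tendsto (fun q : ℝ => q ^ (m + 1) + ((m + 1 : ℕ) : ℝ) * (1 - q)) (𝓝[<] 1)
      (𝓝 (1 ^ (m + 1) + ((m + 1 : ℕ) : ℝ) * (1 - 1))) := by
    have : Continuous fun q : ℝ => q ^ (m + 1) + ((m + 1 : ℕ) : ℝ) * (1 - q) := by fun_prop
    exact (this.tendsto _).mono_left nhdsWithin_le_nhds
  rw [h1]
  refine le_antisymm ?_ ?_
  · simpa using ge_of_tendsto c2 (eventually_of_mem hmem fun q h => (hq q h).2)
  · exact le_of_tendsto c1 (eventually_of_mem hmem fun q h => (hq q h).1)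

/-- The maximum of independent values is itself a value distribution, with the same support. -/
theorem isValueDensity_maxDensity (hf : IsValueDensity f) (m : ℕ) : IsValueDensity (maxDensity m f) where
  nonneg := hf.maxDensity_nonneg m
  isOpen_support := by simpa only [hf.maxDensity_pos_iff] using hf.isOpen_support
  ordConnected_support := by simpa only [hf.maxDensity_pos_iff] using hf.ordConnected_support
  support_nonneg x hx := hf.support_nonneg x ((hf.maxDensity_pos_iff m).1 hx)
  continuousOn := by
    simp only [hf.maxDensity_pos_iff]
    exact (continuousOn_const.mul (hf.continuous_cdf.continuousOn.pow m)).mul hf.continuousOn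
  integral_eq_one := by
    have h1 := (aecover_Iic (μ := (volume : Measure ℝ)) tendsto_id).integral_tendsto_of_countably_generated
      (hf.integrable_maxDensity m)
    simp only [id, hf.integral_Iic_maxDensity] at h1
    have h2 := (tendsto_cdf_atTop (law f)).pow (m + 1)
    rw [one_pow] at h2
    exact tendsto_nhds_unique h1 h2
  finite_mean := by
    refine (hf.finite_mean.norm.const_mul ((m + 1 : ℕ) : ℝ)).mono'
      (measurable_id.mul (hf.measurable_maxDensity m)).aestronglyMeasurable (ae_of_all _ fun x => ?_)
    rw [norm_mul, norm_mul, Real.norm_of_nonneg (hf.maxDensity_nonneg m x),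
      Real.norm_of_nonneg (hf.nonneg x)]
    calc ‖x‖ * maxDensity m f x ≤ ‖x‖ * (((m + 1 : ℕ) : ℝ) * f x) :=
          mul_le_mul_of_nonneg_left (hf.maxDensity_le m x) (norm_nonneg _)
      _ = _ := by ring

theorem cdf_law_maxDensity (hf : IsValueDensity f) (m : ℕ) (x : ℝ) :
    cdf (law (maxDensity m f)) x = cdf (law f) x ^ (m + 1) := by
  rw [(hf.isValueDensity_maxDensity m).cdf_eq_integral, hf.integral_Iic_maxDensity]

end IsValueDensity

/-- The largest coordinate of a vector. -/
def maxValue {m : ℕ} (w : Fin (m + 1) → ℝ) : ℝ := Finset.univ.sup' Finset.univ_nonempty w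

theorem maxValue_le_iff {m : ℕ} {w : Fin (m + 1) → ℝ} {x : ℝ} :
    maxValue w ≤ x ↔ ∀ j, w j ≤ x := by
  simp [maxValue]

theorem le_maxValue {m : ℕ} (w : Fin (m + 1) → ℝ) (j : Fin (m + 1)) : w j ≤ maxValue w :=
  maxValue_le_iff.1 le_rfl j

theorem exists_eq_maxValue {m : ℕ} (w : Fin (m + 1) → ℝ) : ∃ j, maxValue w = w j := by
  obtain ⟨j, -, hj⟩ := Finset.exists_mem_eq_sup' (Finset.univ_nonempty (α := Fin (m + 1))) w
  exact ⟨j, hj⟩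

theorem measurable_maxValue {m : ℕ} : Measurable (maxValue (m := m)) := by
  refine measurable_of_Iic fun x => ?_
  have : maxValue (m := m) ⁻¹' Iic x = Set.pi univ fun _ => Iic x := by
    ext w; simp [maxValue_le_iff, Pi.le_def]
  rw [this]
  exact MeasurableSet.univ_pi fun _ => measurableSet_Iic

theorem IsValueDensity.measurePreserving_maxValue {f : ℝ → ℝ} (hf : IsValueDensity f) (m : ℕ) :
    MeasurePreserving (maxValue (m := m)) (valuesLaw (m + 1) f) (law (maxDensity m f)) := by
  have := hf.isProbabilityMeasure
  have := (hf.isValueDensity_maxDensity m).isProbabilityMeasure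
  refine ⟨measurable_maxValue, ?_⟩
  have : IsProbabilityMeasure (valuesLaw (m + 1) f) := by unfold valuesLaw; infer_instance
  have : IsProbabilityMeasure ((valuesLaw (m + 1) f).map (maxValue (m := m))) :=
    Measure.isProbabilityMeasure_map measurable_maxValue.aemeasurable
  refine Measure.ext_of_Iic _ _ fun x => ?_
  rw [Measure.map_apply measurable_maxValue measurableSet_Iic]
  have h : maxValue (m := m) ⁻¹' Iic x = Set.pi univ fun _ => Iic x := by
    ext w; simp [maxValue_le_iff, Pi.le_def]
  rw [h, valuesLaw, Measure.pi_pi, Finset.prod_const, ← ofReal_cdf, ← ofReal_cdf,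
    hf.cdf_law_maxDensity, ENNReal.ofReal_pow (cdf_nonneg _ _)]
  simp

/-! ### Least concave majorants and their right slopes -/

section LeastConcaveMajorant

/-- The least concave majorant of `R` on `(0, 1)`. -/
noncomputable def leastConcaveMajorant (R : ℝ → ℝ) (q : ℝ) : ℝ :=
  sInf {r | ∃ a b : ℝ, (∀ p ∈ Ioo (0 : ℝ) 1, R p ≤ a + b * p) ∧ r = a + b * q}

/-- The right slope of the least concave majorant. -/
noncomputable def majorantSlope (R : ℝ → ℝ) (q : ℝ) : ℝ :=
  derivWithin (leastConcaveMajorant R) (Ioi q) q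

variable {R : ℝ → ℝ} {C : ℝ}

theorem leastConcaveMajorant_le_line {a b : ℝ} (h : ∀ p ∈ Ioo (0 : ℝ) 1, R p ≤ a + b * p)
    {q : ℝ} (hq : q ∈ Ioo (0 : ℝ) 1) : leastConcaveMajorant R q ≤ a + b * q :=
  csInf_le ⟨R q, by rintro _ ⟨a, b, h, rfl⟩; exact h q hq⟩ ⟨a, b, h, rfl⟩

/-- The bound `C` supplies a majorizing line, so the infimum is not taken over the empty set. -/
theorem le_leastConcaveMajorant_of_lines (hC : ∀ p ∈ Ioo (0 : ℝ) 1, R p ≤ C) {q r : ℝ}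
    (h : ∀ a b : ℝ, (∀ p ∈ Ioo (0 : ℝ) 1, R p ≤ a + b * p) → r ≤ a + b * q) :
    r ≤ leastConcaveMajorant R q :=
  le_csInf ⟨C + 0 * q, C, 0, by simpa using hC, rfl⟩ (by rintro _ ⟨a, b, hab, rfl⟩; exact h a b hab)

theorem le_leastConcaveMajorant (hC : ∀ p ∈ Ioo (0 : ℝ) 1, R p ≤ C) {q : ℝ}
    (hq : q ∈ Ioo (0 : ℝ) 1) : R q ≤ leastConcaveMajorant R q :=
  le_leastConcaveMajorant_of_lines hC fun _ _ h => h q hq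

theorem concaveOn_leastConcaveMajorant (hC : ∀ p ∈ Ioo (0 : ℝ) 1, R p ≤ C) :
    ConcaveOn ℝ (Ioo 0 1) (leastConcaveMajorant R) := by
  refine ⟨convex_Ioo 0 1, fun x hx y hy s t hs ht hst => ?_⟩
  refine le_leastConcaveMajorant_of_lines hC fun a b hab => ?_
  have h1 := mul_le_mul_of_nonneg_left (leastConcaveMajorant_le_line hab hx) hs
  have h2 := mul_le_mul_of_nonneg_left (leastConcaveMajorant_le_line hab hy) ht
  simp only [smul_eq_mul]
  calc _ ≤ s * (a + b * x) + t * (a + b * y) := add_le_add h1 h2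
    _ = (s + t) * a + b * (s * x + t * y) := by ring
    _ = _ := by rw [hst, one_mul]

theorem continuousOn_leastConcaveMajorant (hC : ∀ p ∈ Ioo (0 : ℝ) 1, R p ≤ C) :
    ContinuousOn (leastConcaveMajorant R) (Ioo 0 1) :=
  (concaveOn_leastConcaveMajorant hC).continuousOn isOpen_Ioo

/-- Concavity on an open interval gives one-sided derivatives everywhere, so the `derivWithin` in
`majorantSlope` is never a default value on `(0, 1)`. -/
theorem hasDerivWithinAt_leastConcaveMajorant (hC : ∀ p ∈ Ioo (0 : ℝ) 1, R p ≤ C) {q : ℝ}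
    (hq : q ∈ Ioo (0 : ℝ) 1) :
    HasDerivWithinAt (leastConcaveMajorant R) (majorantSlope R q) (Ioi q) q := by
  have hq' : q ∈ interior (Ioo (0 : ℝ) 1) := by rwa [isOpen_Ioo.interior_eq]
  have h := ((concaveOn_leastConcaveMajorant hC).neg.differentiableWithinAt_Ioi_of_mem_interior
    hq').neg
  rw [neg_neg] at h
  exact h.hasDerivWithinAt

theorem leastConcaveMajorant_le_tangent (hC : ∀ p ∈ Ioo (0 : ℝ) 1, R p ≤ C) {q q' : ℝ}
    (hq : q ∈ Ioo (0 : ℝ) 1) (hq' : q' ∈ Ioo (0 : ℝ) 1) :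
    leastConcaveMajorant R q' ≤ leastConcaveMajorant R q + majorantSlope R q * (q' - q) := by
  have hc := concaveOn_leastConcaveMajorant hC
  have hd := hasDerivWithinAt_leastConcaveMajorant hC hq
  rcases lt_trichotomy q q' with h | rfl | h
  · have := hc.slope_le_of_hasDerivWithinAt_Ioi hq hq' h hd
    rw [slope_def_field, div_le_iff₀ (sub_pos.2 h)] at this
    linarith
  · simp
  · have hlim := (hasDerivWithinAt_iff_tendsto_slope' self_notMem_Ioi).1 hd
    -- The chord from `q'` up to `q` is at least as steep as every chord from `q` to the right, and
    -- the right derivative is the limit of the latter.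
    have hle : majorantSlope R q ≤ slope (leastConcaveMajorant R) q q' := by
      refine le_of_tendsto hlim ?_
      filter_upwards [Ioo_mem_nhdsGT hq.2] with t ht
      have h1 := hc.slope_anti_adjacent hq' ⟨hq.1.trans ht.1, ht.2⟩ h ht.1
      rw [slope_def_field, slope_def_field, ← neg_sub q q',
        ← neg_sub (leastConcaveMajorant R q) (leastConcaveMajorant R q'), neg_div_neg_eq]
      exact h1
    rw [slope_def_field, le_div_iff_of_neg (sub_neg.2 h)] at hle
    linarith

theorem antitoneOn_majorantSlope (hC : ∀ p ∈ Ioo (0 : ℝ) 1, R p ≤ C) :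
    AntitoneOn (majorantSlope R) (Ioo 0 1) := by
  intro q hq q' hq' h
  rcases h.eq_or_lt with rfl | h
  · rfl
  have h1 := leastConcaveMajorant_le_tangent hC hq hq'
  have h2 := leastConcaveMajorant_le_tangent hC hq' hq
  have : 0 ≤ (majorantSlope R q - majorantSlope R q') * (q' - q) := by linarith
  have := nonneg_of_mul_nonneg_left this (sub_pos.2 h)
  linarith

/-- If the slope of the least concave majorant `S` of `R` crosses the level `v` at `q₀`, and
`R ≤ r` near `q₀`, then the line of slope `v` through `(q₀, r)` dominates `S`. -/
theorem leastConcaveMajorant_le_of_slope_crossing (hC : ∀ p ∈ Ioo (0 : ℝ) 1, R p ≤ C)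
    {v q₀ r : ℝ} (h0 : 0 < q₀) (h1 : q₀ ≤ 1)
    (hlt : ∀ q ∈ Ioo (0 : ℝ) 1, q < q₀ → v ≤ majorantSlope R q)
    (hgt : ∀ q ∈ Ioo (0 : ℝ) 1, q₀ < q → majorantSlope R q < v)
    (hr : ∀ ε > 0, ∃ η > 0, ∀ q ∈ Ioo (0 : ℝ) 1, |q - q₀| < η → R q ≤ r + ε) :
    ∀ q ∈ Ioo (0 : ℝ) 1, leastConcaveMajorant R q ≤ r + v * (q - q₀) := by
  set S := leastConcaveMajorant R with hS
  -- the supremum of `R q - v * q`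
  set M := sSup ((fun q => R q - v * q) '' Ioo (0 : ℝ) 1) with hM
  have hbdd : BddAbove ((fun q => R q - v * q) '' Ioo (0 : ℝ) 1) := by
    refine ⟨C + |v|, ?_⟩
    rintro _ ⟨q, hq, rfl⟩
    have h2 : -(v * q) ≤ |v| := by
      calc -(v * q) ≤ |v * q| := neg_le_abs _
        _ = |v| * q := by rw [abs_mul, abs_of_pos hq.1]
        _ ≤ |v| := mul_le_of_le_one_right (abs_nonneg _) hq.2.le
    have := hC q hq
    linarith
  have hRM : ∀ q ∈ Ioo (0 : ℝ) 1, R q ≤ M + v * q := fun q hq => by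
    have := le_csSup hbdd (mem_image_of_mem _ hq)
    linarith
  have hSM : ∀ q ∈ Ioo (0 : ℝ) 1, S q ≤ M + v * q := fun q hq =>
    leastConcaveMajorant_le_line hRM hq
  -- If `M` were larger, `R` would stay away from the line of slope `v` and height `M` both near
  -- `q₀` and to its right. The line could then be tilted about `q₀` and lowered, which forces `R q
  -- - v * q` below `M` uniformly.
  suffices hMr : M ≤ r - v * q₀ from fun q hq => (hSM q hq).trans (by linarith)
  by_contra! hcon
  -- some uniform gap `c` away from the maximum, obtained by tilting the line
  obtain ⟨c, hc, hgap⟩ : ∃ c > 0, ∃ ε > 0, ∀ q ∈ Ioo (0 : ℝ) 1,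
      R q ≤ M - c + v * q - ε * (q - q₀) := by
    -- One third of the gap pays for the error in `hr`, one third for the variation of `v * q`
    -- within distance `η`, and one third is left over.
    set δ := (M - (r - v * q₀)) / 3 with hδ
    have hδ0 : 0 < δ := by rw [hδ]; linarith
    obtain ⟨η₁, hη₁, hR1⟩ := hr δ hδ0
    obtain ⟨η, hη, hη1, hηv, hη'⟩ : ∃ η > 0, η < η₁ ∧ |v| * η ≤ δ ∧ η ≤ 1 := by
      refine ⟨min (min (η₁ / 2) (δ / (|v| + 1))) 1, by positivity, ?_, ?_, min_le_right _ _⟩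
      · exact (min_le_left _ _).trans_lt ((min_le_left _ _).trans_lt (by linarith))
      · have : min (min (η₁ / 2) (δ / (|v| + 1))) 1 ≤ δ / (|v| + 1) :=
          (min_le_left _ _).trans (min_le_right _ _)
        rw [le_div_iff₀ (by positivity)] at this
        nlinarith [abs_nonneg v, show 0 < min (min (η₁ / 2) (δ / (|v| + 1))) 1 by positivity]
    have hnear : ∀ q ∈ Ioo (0 : ℝ) 1, |q - q₀| < η → R q ≤ M - δ + v * q := by
      intro q hq hqη
      have e1 := hR1 q hq (hqη.trans hη1)
      have e2 : -(v * (q - q₀)) ≤ δ := by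
        calc -(v * (q - q₀)) ≤ |v * (q - q₀)| := neg_le_abs _
          _ = |v| * |q - q₀| := abs_mul _ _
          _ ≤ |v| * η := mul_le_mul_of_nonneg_left hqη.le (abs_nonneg _)
          _ ≤ δ := hηv
      have : M = r - v * q₀ + 3 * δ := by rw [hδ]; ring
      linarith
    -- Since the slope at `q₀ + η / 2` is strictly less than `v`, a gap has opened by `q₀ + η`;
    -- slopes below `v` keep it from closing further right.
    obtain ⟨κ, hκ, hfar⟩ : ∃ κ > 0, ∀ q ∈ Ioo (0 : ℝ) 1, q₀ + η ≤ q → R q ≤ M - κ + v * q := by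
      by_cases hq1 : q₀ + η < 1
      · have m1 : q₀ + η ∈ Ioo (0 : ℝ) 1 := ⟨by linarith, hq1⟩
        have m2 : q₀ + η / 2 ∈ Ioo (0 : ℝ) 1 := ⟨by linarith, by linarith⟩
        have e1 := leastConcaveMajorant_le_tangent hC m2 m1
        have e2 := hgt _ m2 (by linarith)
        have e3 := hSM _ m2
        have e4 := hgt _ m1 (by linarith)
        refine ⟨M - (S (q₀ + η) - v * (q₀ + η)), ?_, ?_⟩
        · have : majorantSlope R (q₀ + η / 2) * (q₀ + η - (q₀ + η / 2)) < v * (η / 2) := by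
            rw [show q₀ + η - (q₀ + η / 2) = η / 2 by ring]
            exact mul_lt_mul_of_pos_right e2 (by linarith)
          have : S (q₀ + η) < M + v * (q₀ + η / 2) + v * (η / 2) := by linarith
          linarith
        · intro q hq hle
          have e5 := leastConcaveMajorant_le_tangent hC m1 hq
          have e6 := le_leastConcaveMajorant hC hq
          have : majorantSlope R (q₀ + η) * (q - (q₀ + η)) ≤ v * (q - (q₀ + η)) :=
            mul_le_mul_of_nonneg_right e4.le (by linarith)
          have : R q ≤ S (q₀ + η) + v * (q - (q₀ + η)) := by linarith
          linarith
      · exact ⟨1, one_pos, fun q hq hle => absurd hq.2 (by linarith)⟩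
    -- Near `q₀` and to the right, tilting by `ε` and lowering by `ε * η` cost at most `δ` or `κ`.
    -- At distance `η` or more to the left, the tilt itself gains `ε * η`.
    set ε := min (δ / 2) (κ / 2) with hε
    have hε0 : 0 < ε := by rw [hε]; positivity
    have hεδ : ε ≤ δ / 2 := min_le_left _ _
    have hεκ : ε ≤ κ / 2 := min_le_right _ _
    have hεη : ε * η ≤ ε := mul_le_of_le_one_right hε0.le hη'
    refine ⟨ε * η, by positivity, ε, hε0, fun q hq => ?_⟩
    rcases lt_or_ge |q - q₀| η with h | h
    · have e1 := hnear q hq h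
      have e2 : ε * (q - q₀) ≤ ε * η := mul_le_mul_of_nonneg_left (abs_lt.1 h).2.le hε0.le
      linarith
    · rcases le_abs.1 h with h | h
      · have e1 := hfar q hq (by linarith)
        have e2 : ε * (q - q₀) ≤ ε * 1 :=
          mul_le_mul_of_nonneg_left (by linarith [hq.2]) hε0.le
        linarith
      · have e1 := hRM q hq
        have e2 : ε * η ≤ ε * -(q - q₀) := mul_le_mul_of_nonneg_left h hε0.le
        linarith
  obtain ⟨ε, hε, hgap⟩ := hgap
  have hSgap : ∀ q ∈ Ioo (0 : ℝ) 1, S q ≤ M - c + v * q - ε * (q - q₀) := by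
    intro q hq
    have := leastConcaveMajorant_le_line (R := R) (a := M - c + ε * q₀) (b := v - ε)
      (fun p hp => (hgap p hp).trans (by linarith)) hq
    linarith
  -- hence `R q ≤ M - c + v * q` everywhere
  have hall : ∀ q ∈ Ioo (0 : ℝ) 1, R q - v * q ≤ M - c := by
    intro q hq
    have hRS := le_leastConcaveMajorant hC hq
    rcases le_or_gt q₀ q with h | h
    · have := hSgap q hq
      have : 0 ≤ ε * (q - q₀) := mul_nonneg hε.le (sub_nonneg.2 h)
      linarith
    -- Left of `q₀` the slope is at least `v`, so `S q - v * q ≤ S t - v * t`; as `t` tends to `q₀`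
    -- the tilt disappears.
    · have hev : ∀ t ∈ Ioo q q₀, R q - v * q ≤ M - c + ε * (q₀ - t) := by
        intro t ht
        have mt : t ∈ Ioo (0 : ℝ) 1 := ⟨hq.1.trans ht.1, ht.2.trans_le h1⟩
        have e1 := leastConcaveMajorant_le_tangent hC mt hq
        have e2 := hlt t mt ht.2
        have e3 : v * (t - q) ≤ majorantSlope R t * (t - q) :=
          mul_le_mul_of_nonneg_right e2 (sub_nonneg.2 ht.1.le)
        have e4 := hSgap t mt
        linarith
      have ht : Tendsto (fun t => M - c + ε * (q₀ - t)) (𝓝[<] q₀) (𝓝 (M - c + ε * (q₀ - q₀))) := by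
        have : Continuous fun t => M - c + ε * (q₀ - t) := by fun_prop
        exact (this.tendsto _).mono_left nhdsWithin_le_nhds
      simpa using ge_of_tendsto ht (eventually_of_mem (Ioo_mem_nhdsLT h) hev)
  have : M ≤ M - c := csSup_le ⟨_, mem_image_of_mem _ (show (1 / 2 : ℝ) ∈ Ioo (0 : ℝ) 1 by norm_num)⟩
    (by rintro _ ⟨q, hq, rfl⟩; exact hall q hq)
  linarith

end LeastConcaveMajorant

/-! ### Conditional means below a level, and the bound on first-price payoffs -/

/-- The mean of a value with density `h`, conditional on being below `x`. -/
noncomputable def meanBelow (h : ℝ → ℝ) (x : ℝ) : ℝ :=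
  (∫ y in Iic x, y ∂law h) / cdf (law h) x

/-- The expected gain `E[(x - Y)⁺]` for `Y` with density `h`. -/
noncomputable def expectedGain (h : ℝ → ℝ) (x : ℝ) : ℝ := ∫ y, max (x - y) 0 ∂law h

namespace IsValueDensity

variable {h : ℝ → ℝ}

theorem ae_nonneg (hh : IsValueDensity h) : ∀ᵐ y ∂law h, 0 ≤ y :=
  hh.ae_pos.mono fun y hy => hh.support_nonneg y hy

theorem setIntegral_Iic_sub (hh : IsValueDensity h) {x z : ℝ} (hxz : x ≤ z) :
    (∫ y in Iic z, y ∂law h) - (∫ y in Iic x, y ∂law h) = ∫ y in Ioc x z, y ∂law h := by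
  rw [← Iic_union_Ioc_eq_Iic hxz, setIntegral_union (Iic_disjoint_Ioc le_rfl) measurableSet_Ioc
    hh.integrable_id_law.integrableOn hh.integrable_id_law.integrableOn]
  ring

theorem real_Ioc (hh : IsValueDensity h) {x z : ℝ} (hxz : x ≤ z) :
    (law h).real (Ioc x z) = cdf (law h) z - cdf (law h) x := by
  have := hh.isProbabilityMeasure
  rw [hh.cdf_eq_real_Iic, hh.cdf_eq_real_Iic, ← Iic_union_Ioc_eq_Iic hxz,
    measureReal_union (Iic_disjoint_Ioc le_rfl) measurableSet_Ioc]
  ring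

theorem le_setIntegral_Iic_sub (hh : IsValueDensity h) {x z : ℝ} (hxz : x ≤ z) :
    x * (cdf (law h) z - cdf (law h) x) ≤
      (∫ y in Iic z, y ∂law h) - (∫ y in Iic x, y ∂law h) := by
  have := hh.isProbabilityMeasure
  rw [hh.setIntegral_Iic_sub hxz, ← hh.real_Ioc hxz, mul_comm, ← smul_eq_mul, ← setIntegral_const]
  exact setIntegral_mono_on (integrable_const _).integrableOn hh.integrable_id_law.integrableOn
    measurableSet_Ioc fun y hy => hy.1.le

theorem setIntegral_Iic_sub_le (hh : IsValueDensity h) {x z : ℝ} (hxz : x ≤ z) :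
    (∫ y in Iic z, y ∂law h) - (∫ y in Iic x, y ∂law h) ≤
      z * (cdf (law h) z - cdf (law h) x) := by
  have := hh.isProbabilityMeasure
  rw [hh.setIntegral_Iic_sub hxz, ← hh.real_Ioc hxz, mul_comm, ← smul_eq_mul, ← setIntegral_const]
  exact setIntegral_mono_on hh.integrable_id_law.integrableOn (integrable_const _).integrableOn
    measurableSet_Ioc fun y hy => hy.2

theorem setIntegral_Iic_le (hh : IsValueDensity h) (x : ℝ) :
    ∫ y in Iic x, y ∂law h ≤ x * cdf (law h) x := by
  have := hh.isProbabilityMeasure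
  rw [hh.cdf_eq_real_Iic, mul_comm, ← smul_eq_mul, ← setIntegral_const]
  exact setIntegral_mono_on hh.integrable_id_law.integrableOn (integrable_const _).integrableOn
    measurableSet_Iic fun y hy => hy

theorem setIntegral_Iic_lt (hh : IsValueDensity h) {x : ℝ} (hx : 0 < h x) :
    ∫ y in Iic x, y ∂law h < x * cdf (law h) x := by
  obtain ⟨y, hyx, hy⟩ := hh.exists_lt hx
  have h1 := hh.setIntegral_Iic_le y
  have h2 := hh.setIntegral_Iic_sub_le hyx.le
  nlinarith [hh.cdf_pos hy]

theorem setIntegral_Iic_nonneg (hh : IsValueDensity h) (x : ℝ) : 0 ≤ ∫ y in Iic x, y ∂law h :=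
  integral_nonneg_of_ae (ae_restrict_of_ae hh.ae_nonneg)

theorem meanBelow_mul_cdf (hh : IsValueDensity h) {x : ℝ} (hx : 0 < h x) :
    meanBelow h x * cdf (law h) x = ∫ y in Iic x, y ∂law h :=
  div_mul_cancel₀ _ (hh.cdf_pos hx).ne'

theorem meanBelow_nonneg (hh : IsValueDensity h) (x : ℝ) : 0 ≤ meanBelow h x :=
  div_nonneg (hh.setIntegral_Iic_nonneg x) (cdf_nonneg _ _)

/-- The mean is a weighted average of the conditional means below and above `x`. This bounds the
bids even when the support is unbounded. -/
theorem meanBelow_le_mean (hh : IsValueDensity h) {x : ℝ} (hx : 0 < h x) :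
    meanBelow h x ≤ ∫ y, y ∂law h := by
  have := hh.isProbabilityMeasure
  have h1 := hh.setIntegral_Iic_le x
  have h2 : x * (1 - cdf (law h) x) ≤ ∫ y in Ioi x, y ∂law h := by
    rw [hh.one_sub_cdf', mul_comm, ← smul_eq_mul, ← setIntegral_const]
    exact setIntegral_mono_on (integrable_const _).integrableOn hh.integrable_id_law.integrableOn
      measurableSet_Ioi fun y hy => (mem_Ioi.1 hy).le
  have h3 := integral_add_compl (measurableSet_Iic (a := x)) hh.integrable_id_law
  rw [compl_Iic] at h3
  rw [meanBelow, div_le_iff₀ (hh.cdf_pos hx), ← h3]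
  have := hh.cdf_pos hx
  have := hh.cdf_lt_one hx
  nlinarith

/-- Passing from `x` to `z` adds mass at values above `x`, while the conditional mean below `x` is
strictly less than `x`. -/
theorem strictMonoOn_meanBelow (hh : IsValueDensity h) :
    StrictMonoOn (meanBelow h) {x | 0 < h x} := by
  intro x hx z hz hxz
  have h1 := hh.setIntegral_Iic_lt hx
  have h2 := hh.le_setIntegral_Iic_sub hxz.le
  have h3 := hh.strictMonoOn_cdf hx hz hxz
  have h4 := hh.cdf_pos hx
  rw [meanBelow, meanBelow, div_lt_div_iff₀ h4 (hh.cdf_pos hz)]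
  have e1 := mul_lt_mul_of_pos_right h1 (sub_pos.2 h3)
  have e2 := mul_le_mul_of_nonneg_right h2 h4.le
  nlinarith

theorem continuous_setIntegral_Iic (hh : IsValueDensity h) :
    Continuous fun x => ∫ y in Iic x, y ∂law h := by
  simp only [hh.setIntegral_law _ measurableSet_Iic]
  exact continuous_integral_Iic hh.finite_mean

theorem continuousOn_meanBelow (hh : IsValueDensity h) :
    ContinuousOn (meanBelow h) {x | 0 < h x} :=
  hh.continuous_setIntegral_Iic.continuousOn.div hh.continuous_cdf.continuousOn
    fun _ hx => (hh.cdf_pos hx).ne'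

theorem measurable_meanBelow (hh : IsValueDensity h) : Measurable (meanBelow h) :=
  hh.continuous_setIntegral_Iic.measurable.div hh.continuous_cdf.measurable

theorem integrable_gain (hh : IsValueDensity h) (x : ℝ) :
    Integrable (fun y => max (x - y) 0) (law h) := by
  have := hh.isProbabilityMeasure
  exact ((integrable_const x).sub hh.integrable_id_law).pos_part

theorem expectedGain_nonneg (x : ℝ) : 0 ≤ expectedGain h x :=
  integral_nonneg fun _ => le_max_right _ _

theorem expectedGain_eq (hh : IsValueDensity h) (x : ℝ) :
    expectedGain h x = x * cdf (law h) x - ∫ y in Iic x, y ∂law h := by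
  have := hh.isProbabilityMeasure
  have h1 : (fun y => max (x - y) 0) = (Iic x).indicator fun y => x - y := by
    funext y
    by_cases hy : y ≤ x
    · simp [hy]
    · simp [hy, le_of_not_ge hy]
  rw [expectedGain, h1, integral_indicator measurableSet_Iic,
    integral_sub (integrable_const _).integrableOn hh.integrable_id_law.integrableOn,
    setIntegral_const, hh.cdf_eq_real_Iic, smul_eq_mul, mul_comm]

theorem continuous_expectedGain (hh : IsValueDensity h) : Continuous (expectedGain h) := by
  rw [show expectedGain h = fun x => x * cdf (law h) x - ∫ y in Iic x, y ∂law h from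
    funext hh.expectedGain_eq]
  exact (continuous_id.mul hh.continuous_cdf).sub hh.continuous_setIntegral_Iic

theorem expectedGain_le_abs (hh : IsValueDensity h) (x : ℝ) : expectedGain h x ≤ |x| := by
  rw [hh.expectedGain_eq]
  have h1 := hh.setIntegral_Iic_nonneg x
  have h2 : x * cdf (law h) x ≤ |x| :=
    (mul_le_mul_of_nonneg_right (le_abs_self x) (cdf_nonneg _ _)).trans
      (mul_le_of_le_one_right (abs_nonneg x) (cdf_le_one _ _))
  linarith

theorem integrable_expectedGain (hh : IsValueDensity h) {f : ℝ → ℝ} (hf : IsValueDensity f) :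
    Integrable (expectedGain h) (law f) := by
  refine hf.integrable_id_law.norm.mono' hh.continuous_expectedGain.aestronglyMeasurable
    (ae_of_all _ fun x => ?_)
  rw [Real.norm_of_nonneg (expectedGain_nonneg x)]
  exact hh.expectedGain_le_abs x

theorem meanBelow_le_iff (hh : IsValueDensity h) {x y : ℝ} (hx : 0 < h x) (hy : 0 < h y) :
    meanBelow h x ≤ meanBelow h y ↔ x ≤ y := hh.strictMonoOn_meanBelow.le_iff_le hx hy

/-- Winning against bids `meanBelow h Y` below one's own bid gives the whole expected gain. -/
theorem sub_meanBelow_mul (hh : IsValueDensity h) {x : ℝ} (hx : 0 < h x) :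
    (x - meanBelow h x) * (law h).real {y | meanBelow h y ≤ meanBelow h x} = expectedGain h x := by
  have h1 : (law h).real {y | meanBelow h y ≤ meanBelow h x} = cdf (law h) x := by
    rw [hh.cdf_eq_real_Iic]
    refine measureReal_congr ?_
    filter_upwards [hh.ae_pos] with y hy
    exact propext (hh.meanBelow_le_iff hy hx)
  rw [h1, hh.expectedGain_eq, ← hh.meanBelow_mul_cdf hx]
  ring

/-- No bid does better than the expected gain against bids `meanBelow h Y`. -/
theorem sub_mul_le_expectedGain (hh : IsValueDensity h) (x c : ℝ) :
    (x - c) * (law h).real {y | meanBelow h y ≤ c} ≤ expectedGain h x := by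
  have := hh.isProbabilityMeasure
  set s : Set ℝ := {y | 0 < h y ∧ meanBelow h y ≤ c} with hs
  have hs_meas : MeasurableSet s :=
    hh.measurableSet_support.inter (hh.measurable_meanBelow measurableSet_Iic)
  have h1 : (law h).real {y | meanBelow h y ≤ c} = (law h).real s := by
    refine measureReal_congr ?_
    filter_upwards [hh.ae_pos] with y hy
    exact propext ⟨fun h => ⟨hy, h⟩, fun h => h.2⟩
  have hint : Integrable (fun y => y - c) (law h) := hh.integrable_id_law.sub (integrable_const _)
  have hint' : Integrable (fun y => x - y) (law h) := (integrable_const _).sub hh.integrable_id_law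
  -- `s` is an initial segment of the support. Up to any `z` in `s` the mean is `meanBelow h z ≤ c`;
  -- the limit over `z` covers the case where `s` has no largest element.
  have key : ∫ y in s, (y - c) ∂law h ≤ 0 := by
    rcases s.eq_empty_or_nonempty with he | hne
    · simp [he]
    have : Nonempty s := hne.to_subtype
    have hconn : s.OrdConnected := ⟨fun y hy z hz t ht => by
      have ht' := hh.ordConnected_support.out hy.1 hz.1 ht
      exact ⟨ht', ((hh.meanBelow_le_iff ht' hz.1).2 ht.2).trans hz.2⟩⟩
    have hcover : AECover ((law h).restrict s) (atTop : Filter s) fun z => Iic (z : ℝ) := by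
      refine ⟨?_, fun _ => measurableSet_Iic⟩
      filter_upwards [ae_restrict_mem hs_meas] with y hy
      exact eventually_ge_atTop (⟨y, hy⟩ : s)
    refine le_of_tendsto (hcover.integral_tendsto_of_countably_generated hint.integrableOn)
      (Eventually.of_forall fun z => ?_)
    have hz := z.2
    rw [Measure.restrict_restrict measurableSet_Iic]
    have : (Iic (z : ℝ) ∩ s : Set ℝ) =ᵐ[law h] Iic (z : ℝ) := by
      filter_upwards [hh.ae_pos] with y hy
      exact propext ⟨fun h => h.1, fun h =>
        ⟨h, hy, ((hh.meanBelow_le_iff hy hz.1).2 h).trans hz.2⟩⟩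
    rw [setIntegral_congr_set this,
      integral_sub hh.integrable_id_law.integrableOn (integrable_const _).integrableOn,
      setIntegral_const, ← hh.cdf_eq_real_Iic, ← hh.meanBelow_mul_cdf hz.1, smul_eq_mul]
    nlinarith [hh.cdf_pos hz.1, hz.2]
  calc (x - c) * (law h).real {y | meanBelow h y ≤ c}
      = (∫ y in s, (x - y) ∂law h) + ∫ y in s, (y - c) ∂law h := by
        rw [← integral_add hint'.integrableOn hint.integrableOn, h1, mul_comm, ← smul_eq_mul, ← setIntegral_const]
        congr 1; funext y; ring
    _ ≤ ∫ y in s, (x - y) ∂law h := by linarith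
    _ ≤ ∫ y in s, max (x - y) 0 ∂law h :=
        setIntegral_mono hint'.integrableOn (hh.integrable_gain x).integrableOn fun y => le_max_left _ _
    _ ≤ expectedGain h x := setIntegral_le_integral (hh.integrable_gain x)
        (ae_of_all _ fun y => le_max_right _ _)

end IsValueDensity

theorem firstPriceBid_eq_meanBelow {f : ℝ → ℝ} (hf : IsValueDensity f) (m : ℕ) :
    firstPriceBid (m + 2) f = meanBelow (maxDensity m f) := by
  funext x
  rw [firstPriceBid, meanBelow, (hf.isValueDensity_maxDensity m).setIntegral_law _ measurableSet_Iic,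
    integral_Iic_eq_integral_Iio, hf.cdf_law_maxDensity]
  rfl

namespace IsValueDensity

variable {f : ℝ → ℝ}

theorem cdf_lt_cdf (hf : IsValueDensity f) {x y : ℝ} (hx : 0 < f x) (hyx : y < x) :
    cdf (law f) y < cdf (law f) x := by
  obtain ⟨l, hl, h⟩ := exists_Ioc_subset_of_mem_nhds (hf.isOpen_support.mem_nhds hx) ⟨y, hyx⟩
  obtain ⟨z, hz⟩ := exists_between (max_lt hl hyx)
  have hz' : 0 < f z := h ⟨(le_max_left _ _).trans_lt hz.1, hz.2.le⟩
  exact (monotone_cdf _ ((le_max_right _ _).trans hz.1.le)).trans_lt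
    (hf.strictMonoOn_cdf hz' hx hz.2)

theorem one_sub_cdf_mem (hf : IsValueDensity f) {x : ℝ} (hx : 0 < f x) :
    1 - cdf (law f) x ∈ Ioo (0 : ℝ) 1 :=
  ⟨sub_pos.2 (hf.cdf_lt_one hx), by linarith [hf.cdf_pos hx]⟩

theorem exists_one_sub_cdf_eq (hf : IsValueDensity f) {q : ℝ} (hq : q ∈ Ioo (0 : ℝ) 1) :
    ∃ x, 0 < f x ∧ 1 - cdf (law f) x = q := by
  obtain ⟨x, hx, h⟩ := hf.exists_cdf_eq (q := 1 - q) (by linarith [hq.2]) (by linarith [hq.1])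
  exact ⟨x, hx, by rw [h]; ring⟩

/-- Points close to `x` from above belong to the support and satisfy any property that holds
near `x`. -/
theorem exists_gt_of_eventually (hf : IsValueDensity f) {x : ℝ} (hx : 0 < f x) {p : ℝ → Prop}
    (hp : ∀ᶠ y in 𝓝[{x | 0 < f x}] x, p y) : ∃ y > x, 0 < f y ∧ p y := by
  rw [hf.isOpen_support.nhdsWithin_eq hx] at hp
  have h1 : ∀ᶠ y in 𝓝[>] x, p y := nhdsWithin_le_nhds hp
  have h2 : ∀ᶠ y in 𝓝[>] x, 0 < f y := nhdsWithin_le_nhds (hf.isOpen_support.mem_nhds hx)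
  obtain ⟨y, ⟨hy1, hy2⟩, hy3⟩ := ((h1.and h2).and self_mem_nhdsWithin).exists
  exact ⟨y, hy3, hy2, hy1⟩

theorem exists_lt_of_eventually (hf : IsValueDensity f) {x : ℝ} (hx : 0 < f x) {p : ℝ → Prop}
    (hp : ∀ᶠ y in 𝓝[{x | 0 < f x}] x, p y) : ∃ y < x, 0 < f y ∧ p y := by
  rw [hf.isOpen_support.nhdsWithin_eq hx] at hp
  have h1 : ∀ᶠ y in 𝓝[<] x, p y := nhdsWithin_le_nhds hp
  have h2 : ∀ᶠ y in 𝓝[<] x, 0 < f y := nhdsWithin_le_nhds (hf.isOpen_support.mem_nhds hx)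
  obtain ⟨y, ⟨hy1, hy2⟩, hy3⟩ := ((h1.and h2).and self_mem_nhdsWithin).exists
  exact ⟨y, hy3, hy2, hy1⟩

/-- Taking the limit along the support as a directed set treats bounded and unbounded supports
alike. -/
theorem tendsto_setIntegral_Ioi (hf : IsValueDensity f) {φ : ℝ → ℝ} (hφ : Integrable φ (law f)) :
    Tendsto (fun y : {x | 0 < f x} => ∫ u in Ioi (y : ℝ), φ u ∂law f) atTop (𝓝 0) := by
  have hcover : AECover (law f) (atTop : Filter {x | 0 < f x}) fun y => Iic (y : ℝ) := by
    refine ⟨?_, fun _ => measurableSet_Iic⟩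
    filter_upwards [hf.ae_pos] with u hu
    exact eventually_ge_atTop (⟨u, hu⟩ : {x | 0 < f x})
  have : (fun y : {x | 0 < f x} => ∫ u in Ioi (y : ℝ), φ u ∂law f) =
      fun y : {x | 0 < f x} => (∫ u, φ u ∂law f) - ∫ u in Iic (y : ℝ), φ u ∂law f := by
    funext y
    rw [← integral_add_compl (measurableSet_Iic (a := (y : ℝ))) hφ, compl_Iic]
    ring
  rw [this]
  have := hf.ordConnected_support
  simpa using (hcover.integral_tendsto_of_countably_generated hφ).const_sub (∫ u, φ u ∂law f)

end IsValueDensity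

/-! ### Revenue curves of report laws -/

namespace IsShading

variable {f γ : ℝ → ℝ}

theorem aemeasurable (hγ : IsShading f γ) : AEMeasurable γ (law f) :=
  hγ.integrable.aestronglyMeasurable.aemeasurable

theorem ae_nonneg (hf : IsValueDensity f) (hγ : IsShading f γ) : ∀ᵐ x ∂law f, 0 ≤ γ x :=
  hf.ae_pos.mono hγ.nonneg

theorem cdf_reportLaw (hf : IsValueDensity f) (hγ : IsShading f γ) (y : ℝ) :
    cdf (reportLaw f γ) y = (law f).real {u | γ u ≤ y} := by
  have := hf.isProbabilityMeasure
  have : IsProbabilityMeasure (reportLaw f γ) := Measure.isProbabilityMeasure_map hγ.aemeasurable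
  rw [cdf_eq_real, reportLaw, map_measureReal_apply_of_aemeasurable hγ.aemeasurable measurableSet_Iic]
  rfl

theorem cdf_reportLaw_apply (hf : IsValueDensity f) (hγ : IsShading f γ) {x : ℝ} (hx : 0 < f x) :
    cdf (reportLaw f γ) (γ x) = cdf (law f) x := by
  rw [cdf_reportLaw hf hγ, hf.cdf_eq_real_Iic]
  refine measureReal_congr ?_
  filter_upwards [hf.ae_pos] with u hu
  exact propext (hγ.strictMonoOn.le_iff_le hu hx)

/-- A level with reports on both sides is itself a report, by continuity of `γ` on an interval. -/
theorem core_reportLaw (hf : IsValueDensity f) (hγ : IsShading f γ) :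
    core (reportLaw f γ) = γ '' {x | 0 < f x} := by
  have := hf.isProbabilityMeasure
  ext y
  constructor
  · rintro ⟨h0, h1⟩
    rw [cdf_reportLaw hf hγ] at h0 h1
    have hl : ∃ u, 0 < f u ∧ γ u ≤ y := by
      by_contra! hcon
      refine h0.ne' ?_
      rw [measureReal_eq_zero_iff]
      refine measure_mono_null (fun u hu => ?_) hf.ae_pos
      exact fun hu' => absurd hu (not_le.2 (hcon u hu'))
    have hr : ∃ u, 0 < f u ∧ y ≤ γ u := by
      by_contra! hcon
      refine h1.ne ?_
      rw [← probReal_univ (μ := law f)]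
      refine measureReal_congr ?_
      filter_upwards [hf.ae_pos] with u hu
      exact propext ⟨fun _ => trivial, fun _ => (hcon u hu).le⟩
    obtain ⟨u, hu, hu'⟩ := hl
    obtain ⟨w, hw, hw'⟩ := hr
    exact hf.ordConnected_support.isPreconnected.intermediate_value hu hw hγ.continuousOn ⟨hu', hw'⟩
  · rintro ⟨x, hx, rfl⟩
    rw [core, mem_ofPred_eq, cdf_reportLaw_apply hf hγ hx]
    exact hf.pos_iff.1 hx

/-- A level `y < γ x` is still below `γ z` for some `z < x` in the support, by continuity, so its
distribution function is strictly smaller than at `γ x`. -/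
theorem quantilePrice_reportLaw (hf : IsValueDensity f) (hγ : IsShading f γ) {x : ℝ}
    (hx : 0 < f x) : quantilePrice (reportLaw f γ) (1 - cdf (law f) x) = γ x := by
  have := hf.isProbabilityMeasure
  have : {y | 1 - (1 - cdf (law f) x) ≤ cdf (reportLaw f γ) y} = Ici (γ x) := by
    ext y
    rw [mem_ofPred_eq, sub_sub_cancel, mem_Ici]
    constructor
    · intro h
      by_contra! hy
      obtain ⟨z, hzx, hz, hyz⟩ := hf.exists_lt_of_eventually hx
        ((hγ.continuousOn x hx).eventually (lt_mem_nhds hy))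
      have : cdf (reportLaw f γ) y ≤ cdf (law f) z := by
        rw [← cdf_reportLaw_apply hf hγ hz]
        exact monotone_cdf _ hyz.le
      exact absurd (h.trans this) (not_le.2 (hf.strictMonoOn_cdf hz hx hzx))
    · intro h
      rw [← cdf_reportLaw_apply hf hγ hx]
      exact monotone_cdf _ h
  rw [quantilePrice, this, csInf_Ici]

theorem revenueCurve_reportLaw (hf : IsValueDensity f) (hγ : IsShading f γ) {x : ℝ}
    (hx : 0 < f x) :
    revenueCurve (reportLaw f γ) (1 - cdf (law f) x) = (1 - cdf (law f) x) * γ x := by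
  rw [revenueCurve, quantilePrice_reportLaw hf hγ hx]

theorem mul_le_setIntegral_Ioi (hf : IsValueDensity f) (hγ : IsShading f γ) {x : ℝ}
    (hx : 0 < f x) : (1 - cdf (law f) x) * γ x ≤ ∫ u in Ioi x, γ u ∂law f := by
  have := hf.isProbabilityMeasure
  rw [hf.one_sub_cdf', ← smul_eq_mul, ← setIntegral_const]
  refine setIntegral_mono_on_ae (integrable_const _).integrableOn hγ.integrable.integrableOn
    measurableSet_Ioi ?_
  filter_upwards [hf.ae_pos] with u hu hxu
  exact (hγ.strictMonoOn hx hu hxu).le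

/-- This is Markov's inequality. The finite mean of the reports is what makes the revenue curve
bounded and its concave majorant meaningful. -/
theorem revenueCurve_le (hf : IsValueDensity f) (hγ : IsShading f γ) :
    ∀ p ∈ Ioo (0 : ℝ) 1, revenueCurve (reportLaw f γ) p ≤ ∫ u, γ u ∂law f := by
  intro p hp
  obtain ⟨x, hx, rfl⟩ := hf.exists_one_sub_cdf_eq hp
  rw [revenueCurve_reportLaw hf hγ hx]
  exact (mul_le_setIntegral_Ioi hf hγ hx).trans
    (setIntegral_le_integral hγ.integrable (ae_nonneg hf hγ))

theorem revenueCurve_nonneg (hf : IsValueDensity f) (hγ : IsShading f γ) :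
    ∀ p ∈ Ioo (0 : ℝ) 1, 0 ≤ revenueCurve (reportLaw f γ) p := by
  intro p hp
  obtain ⟨x, hx, rfl⟩ := hf.exists_one_sub_cdf_eq hp
  rw [revenueCurve_reportLaw hf hγ hx]
  exact mul_nonneg hp.1.le (hγ.nonneg x hx)

theorem ironedVirtualValue_reportLaw (hf : IsValueDensity f) (hγ : IsShading f γ) {x : ℝ}
    (hx : 0 < f x) : ironedVirtualValue (reportLaw f γ) (γ x) =
      majorantSlope (revenueCurve (reportLaw f γ)) (1 - cdf (law f) x) := by
  rw [ironedVirtualValue, cdf_reportLaw_apply hf hγ hx]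
  rfl

theorem monotoneOn_ironedVirtualValue (hf : IsValueDensity f) (hγ : IsShading f γ) :
    MonotoneOn (fun x => ironedVirtualValue (reportLaw f γ) (γ x)) {x | 0 < f x} := by
  intro x hx y hy hxy
  simp only [ironedVirtualValue_reportLaw hf hγ hx, ironedVirtualValue_reportLaw hf hγ hy]
  exact antitoneOn_majorantSlope (revenueCurve_le hf hγ) (hf.one_sub_cdf_mem hy)
    (hf.one_sub_cdf_mem hx) (sub_le_sub_left (monotone_cdf _ hxy) _)

theorem aemeasurable_ironedVirtualValue (hf : IsValueDensity f) (hγ : IsShading f γ) :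
    AEMeasurable (fun x => ironedVirtualValue (reportLaw f γ) (γ x)) (law f) := by
  rw [← hf.restrict_support]
  exact aemeasurable_restrict_of_monotoneOn hf.measurableSet_support
    (monotoneOn_ironedVirtualValue hf hγ)

/-- Between two values in the support, the integral of the ironed virtual value is the increment
of the ironed revenue. -/
theorem setIntegral_Icc_ironedVirtualValue (hf : IsValueDensity f) (hγ : IsShading f γ) {x z : ℝ}
    (hx : 0 < f x) (hz : 0 < f z) (hxz : x ≤ z) :
    ∫ u in Icc x z, ironedVirtualValue (reportLaw f γ) (γ u) ∂law f =
      leastConcaveMajorant (revenueCurve (reportLaw f γ)) (1 - cdf (law f) x) -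
        leastConcaveMajorant (revenueCurve (reportLaw f γ)) (1 - cdf (law f) z) := by
  set ψ : ℝ → ℝ := fun u => ironedVirtualValue (reportLaw f γ) (γ u) with hψ
  set S := leastConcaveMajorant (revenueCurve (reportLaw f γ)) with hS
  have hsub : Icc x z ⊆ {x | 0 < f x} := hf.ordConnected_support.out hx hz
  have hneg : ∀ {s}, s ∈ Icc (-z) (-x) → 0 < f (-s) := fun {s} hs =>
    hsub ⟨le_neg_of_le_neg hs.2, neg_le.1 hs.1⟩
  have hint : IntervalIntegrable (fun u => ψ u * f u) volume x z := by
    refine IntervalIntegrable.mul_continuousOn ?_ ?_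
    · refine MonotoneOn.intervalIntegrable ?_
      rw [uIcc_of_le hxz]
      exact (monotoneOn_ironedVirtualValue hf hγ).mono hsub
    · rw [uIcc_of_le hxz]
      exact hf.continuousOn.mono hsub
  -- The majorant is only known to have right derivatives, and the quantile decreases in `u`; the
  -- substitution `s = -u` makes it increase.
  have hftc : ∫ s in (-z)..(-x), ψ (-s) * f (-s) =
      S (1 - cdf (law f) (- -x)) - S (1 - cdf (law f) (- -z)) := by
    refine intervalIntegral.integral_eq_sub_of_hasDeriv_right_of_le
      (f := fun s => S (1 - cdf (law f) (-s))) (neg_le_neg hxz) ?_ ?_ ?_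
    · refine (continuousOn_leastConcaveMajorant (revenueCurve_le hf hγ)).comp
        (continuous_const.sub (hf.continuous_cdf.comp continuous_neg)).continuousOn ?_
      exact fun s hs => hf.one_sub_cdf_mem (hneg hs)
    · intro s hs
      have hs' := hneg (Ioo_subset_Icc_self hs)
      have h1 : HasDerivAt (fun t => 1 - cdf (law f) (-t)) (f (-s)) s := by
        have := ((hf.hasDerivAt_cdf hs').comp s (hasDerivAt_neg s)).const_sub 1
        simpa [Function.comp_def] using this
      have h2 := hasDerivWithinAt_leastConcaveMajorant (revenueCurve_le hf hγ)
        (hf.one_sub_cdf_mem hs')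
      have h3 := h2.comp s h1.hasDerivWithinAt (s := Ioi s) fun t ht =>
        sub_lt_sub_left (hf.cdf_lt_cdf hs' (neg_lt_neg ht)) _
      simp only [hψ, ironedVirtualValue_reportLaw hf hγ hs']
      exact h3
    · exact ((IntervalIntegrable.iff_comp_neg enorm_ne_top).1 hint).symm
  rw [intervalIntegral.integral_comp_neg (fun u => ψ u * f u)] at hftc
  rw [hf.setIntegral_law _ measurableSet_Icc, integral_Icc_eq_integral_Ioc,
    ← intervalIntegral.integral_of_le hxz]
  simpa only [neg_neg] using hftc

end IsShading

/-! ### Threshold payments dominate ironed virtual values -/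

namespace IsShading

variable {f γ : ℝ → ℝ}

/-- The values at which a bidder shading by `γ` reaches the level `v` in virtual-value space. -/
def winSet (f γ : ℝ → ℝ) (v : ℝ) : Set ℝ :=
  {x | 0 < f x ∧ v ≤ ironedVirtualValue (reportLaw f γ) (γ x)}

/-- The lowest report with which a bidder shading by `γ` reaches the level `v`. -/
noncomputable def winPrice (f γ : ℝ → ℝ) (v : ℝ) : ℝ := sInf (γ '' winSet f γ v)

theorem mem_winSet_of_le (hf : IsValueDensity f) (hγ : IsShading f γ) {v x y : ℝ}
    (hx : x ∈ winSet f γ v) (hy : 0 < f y) (hxy : x ≤ y) : y ∈ winSet f γ v :=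
  ⟨hy, hx.2.trans (monotoneOn_ironedVirtualValue hf hγ hx.1 hy hxy)⟩

theorem ordConnected_winSet (hf : IsValueDensity f) (hγ : IsShading f γ) (v : ℝ) :
    (winSet f γ v).OrdConnected :=
  ⟨fun _ hx _ hy _ ht =>
    mem_winSet_of_le hf hγ hx (hf.ordConnected_support.out hx.1 hy.1 ht) ht.1⟩

theorem winPrice_le (hγ : IsShading f γ) {v x : ℝ} (hx : x ∈ winSet f γ v) :
    winPrice f γ v ≤ γ x :=
  csInf_le ⟨0, by rintro _ ⟨y, hy, rfl⟩; exact hγ.nonneg y hy.1⟩ (mem_image_of_mem γ hx)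

theorem winPrice_nonneg (hγ : IsShading f γ) (v : ℝ) : 0 ≤ winPrice f γ v :=
  Real.sInf_nonneg (by rintro _ ⟨y, hy, rfl⟩; exact hγ.nonneg y hy.1)

theorem le_real_winSet (hf : IsValueDensity f) (hγ : IsShading f γ) {v x : ℝ}
    (hx : x ∈ winSet f γ v) : 1 - cdf (law f) x ≤ (law f).real (winSet f γ v) := by
  have := hf.isProbabilityMeasure
  rw [hf.one_sub_cdf']
  refine ENNReal.toReal_mono (measure_ne_top _ _) (measure_mono_ae ?_)
  filter_upwards [hf.ae_pos] with u hu hxu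
  exact mem_winSet_of_le hf hγ hx hu (mem_Ioi.1 hxu).le

theorem real_winSet_le (hf : IsValueDensity f) (hγ : IsShading f γ) {v x : ℝ} (hx : 0 < f x)
    (hx' : x ∉ winSet f γ v) : (law f).real (winSet f γ v) ≤ 1 - cdf (law f) x := by
  have := hf.isProbabilityMeasure
  rw [hf.one_sub_cdf']
  refine measureReal_mono fun u hu => ?_
  by_contra hux
  exact hx' (mem_winSet_of_le hf hγ hu hx (not_lt.1 hux))

/-- The win set is an upper segment of the support, so the slope of the majorant crosses `v` at the
quantile `q₀` equal to its probability. There the price is `winPrice`. The revenue is controlled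
only near `q₀`, since `q₀` may be `1` and the infimum need not be attained. -/
theorem leastConcaveMajorant_le_of_winSet (hf : IsValueDensity f) (hγ : IsShading f γ) {v : ℝ}
    (hne : (winSet f γ v).Nonempty) : ∀ q ∈ Ioo (0 : ℝ) 1,
    leastConcaveMajorant (revenueCurve (reportLaw f γ)) q ≤
      winPrice f γ v * (law f).real (winSet f γ v) + v * (q - (law f).real (winSet f γ v)) := by
  have := hf.isProbabilityMeasure
  set q₀ := (law f).real (winSet f γ v) with hq₀
  set p := winPrice f γ v with hp
  have hp0 : 0 ≤ p := winPrice_nonneg hγ v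
  obtain ⟨x₀, hx₀⟩ := hne
  have h0 : 0 < q₀ := (hf.one_sub_cdf_mem hx₀.1).1.trans_le (le_real_winSet hf hγ hx₀)
  have h1 : q₀ ≤ 1 := measureReal_le_one
  refine leastConcaveMajorant_le_of_slope_crossing (revenueCurve_le hf hγ) h0 h1 ?_ ?_ ?_
  · intro q hq hlt
    obtain ⟨x, hx, rfl⟩ := hf.exists_one_sub_cdf_eq hq
    rw [← ironedVirtualValue_reportLaw hf hγ hx]
    by_contra hcon
    exact absurd (real_winSet_le hf hγ hx fun h => hcon h.2) (not_le.2 hlt)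
  · intro q hq hlt
    obtain ⟨x, hx, rfl⟩ := hf.exists_one_sub_cdf_eq hq
    rw [← ironedVirtualValue_reportLaw hf hγ hx]
    by_contra! hcon
    exact absurd (le_real_winSet hf hγ (v := v) ⟨hx, hcon⟩) (not_le.2 hlt)
  · intro ε hε
    obtain ⟨_, ⟨x, hx, rfl⟩, hxp⟩ := exists_lt_of_csInf_lt (s := γ '' winSet f γ v)
      ⟨_, mem_image_of_mem γ hx₀⟩ (show sInf (γ '' winSet f γ v) < p + ε / 2 by
        change p < _; linarith)
    -- A point strictly above `x` has quantile strictly below `q₀`, so all quantiles close to `q₀`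
    -- have reports below `p + ε / 2`.
    obtain ⟨x', hxx', hx', hxp'⟩ := hf.exists_gt_of_eventually hx.1
      ((hγ.continuousOn x hx.1).eventually (gt_mem_nhds hxp))
    have hq' : 1 - cdf (law f) x' < q₀ :=
      (sub_lt_sub_left (hf.strictMonoOn_cdf hx.1 hx' hxx') _).trans_le (le_real_winSet hf hγ hx)
    -- The first bound keeps the value below `x'`; the second makes `p * (q - q₀) ≤ ε / 2`, with `p
    -- + 1` avoiding division by zero.
    refine ⟨min (q₀ - (1 - cdf (law f) x')) (ε / (2 * (p + 1))),
      lt_min (sub_pos.2 hq') (by positivity), fun q hq hqη => ?_⟩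
    obtain ⟨u, hu, rfl⟩ := hf.exists_one_sub_cdf_eq hq
    have e1 := (abs_lt.1 (hqη.trans_le (min_le_left _ _))).1
    have e2 := (abs_lt.1 (hqη.trans_le (min_le_right _ _))).2
    have hux : u < x' := (hf.cdf_lt_iff hu hx').1 (by linarith)
    have hγu : γ u < p + ε / 2 := (hγ.strictMonoOn hu hx' hux).trans hxp'
    rw [revenueCurve_reportLaw hf hγ hu]
    rw [lt_div_iff₀ (by positivity)] at e2
    set q := 1 - cdf (law f) u with hq_def
    have e3 : q * γ u ≤ q * (p + ε / 2) := mul_le_mul_of_nonneg_left hγu.le hq.1.le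
    have e4 : q * (ε / 2) ≤ ε / 2 := mul_le_of_le_one_left (by linarith) hq.2.le
    have e5 : p * (q - q₀) ≤ ε / 2 := by
      rcases le_or_gt q q₀ with h | h
      · exact (mul_nonpos_of_nonneg_of_nonpos hp0 (by linarith)).trans (by linarith)
      · nlinarith
    linarith

/-- Over an interval in the win set, the integral is a difference of values of the ironed revenue
curve. The subtracted value is nonnegative; the other is at a quantile at most `q₀`, where the
dominating line of slope `v ≥ 0` is at most its value at `q₀`. Exhausting the win set gives
integrability and the bound together, as the integrand is nonnegative there. -/
theorem integrableOn_winSet_and_le (hf : IsValueDensity f) (hγ : IsShading f γ) {v : ℝ}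
    (hv : 0 ≤ v) :
    IntegrableOn (fun x => ironedVirtualValue (reportLaw f γ) (γ x)) (winSet f γ v) (law f) ∧
      ∫ x in winSet f γ v, ironedVirtualValue (reportLaw f γ) (γ x) ∂law f ≤
        winPrice f γ v * (law f).real (winSet f γ v) := by
  have := hf.isProbabilityMeasure
  rcases (winSet f γ v).eq_empty_or_nonempty with he | hne
  -- Both sides vanish on an empty win set, which has measure zero.
  · simp [he]
  set T := winSet f γ v with hT
  set ψ : ℝ → ℝ := fun x => ironedVirtualValue (reportLaw f γ) (γ x) with hψ
  have hconn := ordConnected_winSet hf hγ v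
  have hTmeas : MeasurableSet T := hconn.measurableSet
  have : Nonempty T := hne.to_subtype
  have hmono : MonotoneOn ψ T := (monotoneOn_ironedVirtualValue hf hγ).mono fun x hx => hx.1
  have hsub : ∀ z : T × T, Icc (z.1 : ℝ) z.2 ⊆ T := fun z => hconn.out z.1.2 z.2.2
  have hcover : AECover ((law f).restrict T) (atBot ×ˢ atTop : Filter (T × T))
      fun z => Icc (z.1 : ℝ) z.2 := by
    refine ⟨?_, fun _ => measurableSet_Icc⟩
    filter_upwards [ae_restrict_mem hTmeas] with y hy
    exact (eventually_le_atBot (⟨y, hy⟩ : T)).prod_mk (eventually_ge_atTop (⟨y, hy⟩ : T))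
  have hrestr : ∀ z : T × T, ((law f).restrict T).restrict (Icc (z.1 : ℝ) z.2) =
      (law f).restrict (Icc (z.1 : ℝ) z.2) := fun z => by
    rw [Measure.restrict_restrict measurableSet_Icc, inter_eq_left.2 (hsub z)]
  have hbound : ∀ z : T × T, ∫ x in Icc (z.1 : ℝ) z.2, ψ x ∂((law f).restrict T) ≤
      winPrice f γ v * (law f).real T := by
    intro z
    rw [hrestr]
    have hr : 0 ≤ winPrice f γ v * (law f).real T :=
      mul_nonneg (winPrice_nonneg hγ v) measureReal_nonneg
    rcases le_or_gt (z.1 : ℝ) z.2 with h | h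
    · rw [setIntegral_Icc_ironedVirtualValue hf hγ z.1.2.1 z.2.2.1 h]
      have e1 := leastConcaveMajorant_le_of_winSet hf hγ hne _ (hf.one_sub_cdf_mem z.1.2.1)
      have e2 := (revenueCurve_nonneg hf hγ _ (hf.one_sub_cdf_mem z.2.2.1)).trans
        (le_leastConcaveMajorant (revenueCurve_le hf hγ) (hf.one_sub_cdf_mem z.2.2.1))
      have e3 : v * (1 - cdf (law f) z.1 - (law f).real (winSet f γ v)) ≤ 0 :=
        mul_nonpos_of_nonneg_of_nonpos hv (sub_nonpos.2 (le_real_winSet hf hγ z.1.2))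
      linarith
    · simpa [Icc_eq_empty (not_le.2 h)] using hr
  have hint : ∀ z : T × T, IntegrableOn ψ (Icc (z.1 : ℝ) z.2) ((law f).restrict T) := fun z => by
    rw [IntegrableOn, hrestr]
    exact (hmono.mono (hsub z)).integrableOn_isCompact isCompact_Icc
  have hi : IntegrableOn ψ T (law f) := by
    refine hcover.integrable_of_integral_bounded_of_nonneg_ae _ hint ?_ (Eventually.of_forall hbound)
    filter_upwards [ae_restrict_mem hTmeas] with x hx
    exact hv.trans hx.2
  exact ⟨hi, le_of_tendsto (hcover.integral_tendsto_of_countably_generated hi)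
    (Eventually.of_forall hbound)⟩

/-- This bound does not depend on `v`; it yields joint integrability over own and opponents' values.
-/
theorem winPrice_mul_le (hf : IsValueDensity f) (hγ : IsShading f γ) (v : ℝ) :
    winPrice f γ v * (law f).real (winSet f γ v) ≤ ∫ x, γ x ∂law f := by
  have := hf.isProbabilityMeasure
  refine le_trans ?_ (setIntegral_le_integral hγ.integrable (ae_nonneg hf hγ) (s := winSet f γ v))
  rw [mul_comm, ← smul_eq_mul, ← setIntegral_const]
  exact setIntegral_mono_on (integrable_const _).integrableOn hγ.integrable.integrableOn
    (ordConnected_winSet hf hγ v).measurableSet fun x hx => winPrice_le hγ hx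

end IsShading

/-! ### The shading equation and the virtual value of its solution -/

/-- The mean of `b` conditional on the value being above `x`. -/
noncomputable def meanAbove (f b : ℝ → ℝ) (x : ℝ) : ℝ :=
  (∫ u in Ioi x, b u ∂law f) / (1 - cdf (law f) x)

/-- A bid function: measurable, nonnegative, bounded, continuous and increasing on the support. -/
structure IsBid (f b : ℝ → ℝ) : Prop where
  measurable : Measurable b
  nonneg : ∀ x, 0 ≤ b x
  bounded : ∃ C, ∀ x, 0 < f x → b x ≤ C
  continuousOn : ContinuousOn b {x | 0 < f x}
  strictMonoOn : StrictMonoOn b {x | 0 < f x}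

namespace IsBid

variable {f b g : ℝ → ℝ}

theorem integrable (hf : IsValueDensity f) (hb : IsBid f b) : Integrable b (law f) := by
  have := hf.isProbabilityMeasure
  obtain ⟨C, hC⟩ := hb.bounded
  refine Integrable.of_bound hb.measurable.aestronglyMeasurable C ?_
  filter_upwards [hf.ae_pos] with x hx
  rw [Real.norm_of_nonneg (hb.nonneg x)]
  exact hC x hx

theorem setIntegral_Ioi_eq (hf : IsValueDensity f) (hb : IsBid f b) :
    (fun x => ∫ u in Ioi x, b u ∂law f) =
      fun x => (∫ u, b u ∂law f) - ∫ u in Iic x, b u * f u := by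
  funext x
  rw [← hf.setIntegral_law _ measurableSet_Iic,
    ← integral_add_compl (measurableSet_Iic (a := x)) (hb.integrable hf), compl_Iic]
  ring

theorem hasDerivAt_setIntegral_Ioi (hf : IsValueDensity f) (hb : IsBid f b) {x : ℝ}
    (hx : 0 < f x) : HasDerivAt (fun x => ∫ u in Ioi x, b u ∂law f) (-(b x * f x)) x := by
  rw [setIntegral_Ioi_eq hf hb]
  refine (hasDerivAt_integral_Iic (hf.integrable_law_iff.1 (hb.integrable hf)) ?_).const_sub _
  exact (hb.continuousOn.continuousAt (hf.isOpen_support.mem_nhds hx)).mul (hf.continuousAt hx)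

theorem measurable_meanAbove (hf : IsValueDensity f) (hb : IsBid f b) :
    Measurable (meanAbove f b) := by
  have : Continuous fun x => ∫ u in Ioi x, b u ∂law f := by
    rw [setIntegral_Ioi_eq hf hb]
    exact continuous_const.sub
      (continuous_integral_Iic (hf.integrable_law_iff.1 (hb.integrable hf)))
  exact this.measurable.div (measurable_const.sub hf.continuous_cdf.measurable)

theorem hasDerivAt_meanAbove (hf : IsValueDensity f) (hb : IsBid f b) {x : ℝ} (hx : 0 < f x) :
    HasDerivAt (meanAbove f b) (f x / (1 - cdf (law f) x) * (meanAbove f b x - b x)) x := by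
  have h0 : 1 - cdf (law f) x ≠ 0 := (hf.one_sub_cdf_mem hx).1.ne'
  refine ((hb.hasDerivAt_setIntegral_Ioi hf hx).div ((hf.hasDerivAt_cdf hx).const_sub 1)
    h0).congr_deriv ?_
  rw [meanAbove]
  field_simp
  ring

/-- Strictness comes from the mass above some `z > x`, where the bid is at least `b z > b x`. It
makes the derivative of `meanAbove` positive. -/
theorem lt_meanAbove (hf : IsValueDensity f) (hb : IsBid f b) {x : ℝ} (hx : 0 < f x) :
    b x < meanAbove f b x := by
  have := hf.isProbabilityMeasure
  obtain ⟨z, hxz, hz⟩ := hf.exists_gt hx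
  have h1 : b x * (cdf (law f) z - cdf (law f) x) ≤ ∫ u in Ioc x z, b u ∂law f := by
    rw [← hf.real_Ioc hxz.le, mul_comm, ← smul_eq_mul, ← setIntegral_const]
    refine setIntegral_mono_on_ae (integrable_const _).integrableOn
      (hb.integrable hf).integrableOn measurableSet_Ioc ?_
    filter_upwards [hf.ae_pos] with u hu hxu
    exact (hb.strictMonoOn hx hu hxu.1).le
  have h2 : b z * (1 - cdf (law f) z) ≤ ∫ u in Ioi z, b u ∂law f := by
    rw [hf.one_sub_cdf', mul_comm, ← smul_eq_mul, ← setIntegral_const]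
    refine setIntegral_mono_on_ae (integrable_const _).integrableOn
      (hb.integrable hf).integrableOn measurableSet_Ioi ?_
    filter_upwards [hf.ae_pos] with u hu hxu
    exact (hb.strictMonoOn hz hu hxu).le
  have h3 := mul_lt_mul_of_pos_right (hb.strictMonoOn hx hz hxz) (hf.one_sub_cdf_mem hz).1
  rw [meanAbove, lt_div_iff₀ (hf.one_sub_cdf_mem hx).1, ← Ioc_union_Ioi_eq_Ioi hxz.le,
    setIntegral_union (Ioc_disjoint_Ioi le_rfl) measurableSet_Ioi
      (hb.integrable hf).integrableOn (hb.integrable hf).integrableOn]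
  linarith

theorem meanAbove_le (hf : IsValueDensity f) (hb : IsBid f b) {C : ℝ}
    (hC : ∀ x, 0 < f x → b x ≤ C) {x : ℝ} (hx : 0 < f x) : meanAbove f b x ≤ C := by
  have := hf.isProbabilityMeasure
  rw [meanAbove, div_le_iff₀ (hf.one_sub_cdf_mem hx).1, hf.one_sub_cdf', mul_comm, ← smul_eq_mul,
    ← setIntegral_const]
  exact setIntegral_mono_ae (hb.integrable hf).integrableOn (integrable_const _).integrableOn
    (hf.ae_pos.mono hC)

theorem strictMonoOn_meanAbove (hf : IsValueDensity f) (hb : IsBid f b) :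
    StrictMonoOn (meanAbove f b) {x | 0 < f x} := by
  refine strictMonoOn_of_deriv_pos hf.ordConnected_support.convex
    (fun x hx => (hasDerivAt_meanAbove hf hb hx).continuousAt.continuousWithinAt) fun x hx => ?_
  have hx' : x ∈ {x | 0 < f x} := interior_subset hx
  rw [(hasDerivAt_meanAbove hf hb hx').deriv]
  exact mul_pos (div_pos hx' (hf.one_sub_cdf_mem hx').1) (sub_pos.2 (lt_meanAbove hf hb hx'))

theorem isShading_meanAbove (hf : IsValueDensity f) (hb : IsBid f b) :
    IsShading f (meanAbove f b) where
  continuousOn x hx := (hasDerivAt_meanAbove hf hb hx).continuousAt.continuousWithinAt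
  strictMonoOn := strictMonoOn_meanAbove hf hb
  nonneg x hx := (hb.nonneg x).trans (lt_meanAbove hf hb hx).le
  integrable := by
    have := hf.isProbabilityMeasure
    obtain ⟨C, hC⟩ := hb.bounded
    refine Integrable.of_bound (measurable_meanAbove hf hb).aestronglyMeasurable C ?_
    filter_upwards [hf.ae_pos] with x hx
    rw [Real.norm_of_nonneg ((hb.nonneg x).trans (lt_meanAbove hf hb hx).le)]
    exact meanAbove_le hf hb hC hx

theorem virtualValue_sub (hf : IsValueDensity f) {x : ℝ} (hx : 0 < f x) :
    virtualValue (law f) x - x = -((1 - cdf (law f) x) / f x) := by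
  rw [virtualValue, (hf.hasDerivAt_cdf hx).deriv]
  ring

theorem meanAbove_solves (hf : IsValueDensity f) (hb : IsBid f b) {x : ℝ} (hx : 0 < f x) :
    DifferentiableAt ℝ (meanAbove f b) x ∧
      meanAbove f b x + deriv (meanAbove f b) x * (virtualValue (law f) x - x) = b x := by
  refine ⟨(hasDerivAt_meanAbove hf hb hx).differentiableAt, ?_⟩
  rw [(hasDerivAt_meanAbove hf hb hx).deriv, virtualValue_sub hf hx]
  have h0 : 1 - cdf (law f) x ≠ 0 := (hf.one_sub_cdf_mem hx).1.ne'
  field_simp [hx.ne']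
  ring

/-- A shading function of finite mean that solves the shading equation is the conditional mean of
the bid. -/
theorem eq_meanAbove_of_solves (hf : IsValueDensity f) (hb : IsBid f b) (hg : IsShading f g)
    (h : ∀ x, 0 < f x → DifferentiableAt ℝ g x ∧
      g x + deriv g x * (virtualValue (law f) x - x) = b x) {x : ℝ} (hx : 0 < f x) :
    g x = meanAbove f b x := by
  set D : ℝ → ℝ := fun x => (1 - cdf (law f) x) * g x - ∫ u in Ioi x, b u ∂law f with hD
  have hderiv : ∀ {y}, 0 < f y → HasDerivAt D 0 y := fun {y} hy => by
    have h1 := (((hf.hasDerivAt_cdf hy).const_sub 1).mul (h y hy).1.hasDerivAt).sub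
      (hb.hasDerivAt_setIntegral_Ioi hf hy)
    refine h1.congr_deriv ?_
    have h2 := (h y hy).2
    rw [virtualValue_sub hf hy] at h2
    rw [← h2]
    field_simp [hy.ne']
    ring
  have hconst : ∀ {y}, 0 < f y → D x = D y := fun {y} hy =>
    hf.isOpen_support.is_const_of_deriv_eq_zero hf.ordConnected_support.isPreconnected
      (fun z hz => (hderiv hz).differentiableAt.differentiableWithinAt)
      (fun z hz => (hderiv hz).deriv) hx hy
  -- The equation fixes `g` only up to a multiple of `1 / (1 - F)`. The constant `D` is bounded by
  -- tails of integrable functions, so this multiple is zero.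
  have hbound : ∀ y : {x | 0 < f x}, |D x| ≤
      (∫ u in Ioi (y : ℝ), g u ∂law f) + ∫ u in Ioi (y : ℝ), b u ∂law f := by
    rintro ⟨y, hy⟩
    rw [hconst hy]
    refine (abs_sub _ _).trans (add_le_add ?_ ?_)
    · rw [abs_of_nonneg (mul_nonneg (hf.one_sub_cdf_mem hy).1.le (hg.nonneg y hy))]
      exact hg.mul_le_setIntegral_Ioi hf hy
    · rw [abs_of_nonneg (integral_nonneg hb.nonneg)]
  have hne : Nonempty {x | 0 < f x} := ⟨⟨x, hx⟩⟩
  have hlim := (hf.tendsto_setIntegral_Ioi hg.integrable).add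
    (hf.tendsto_setIntegral_Ioi (hb.integrable hf))
  rw [add_zero] at hlim
  have hD0 : D x = 0 := abs_nonpos_iff.1 (ge_of_tendsto hlim (Eventually.of_forall hbound))
  rw [meanAbove, eq_div_iff (hf.one_sub_cdf_mem hx).1.ne']
  simp only [hD] at hD0
  linarith

/-- With reports `meanAbove f b`, the ironed virtual value is the bid. -/
theorem ironedVirtualValue_eq (hf : IsValueDensity f) (hb : IsBid f b) (hg : IsShading f g)
    (h : ∀ x, 0 < f x → g x = meanAbove f b x) {x : ℝ} (hx : 0 < f x) :
    ironedVirtualValue (reportLaw f g) (g x) = b x := by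
  have := hf.isProbabilityMeasure
  set R := revenueCurve (reportLaw f g) with hR
  have hC := hg.revenueCurve_le hf
  have hRB : ∀ {y}, 0 < f y → R (1 - cdf (law f) y) = ∫ u in Ioi y, b u ∂law f := fun {y} hy => by
    rw [hR, hg.revenueCurve_reportLaw hf hy, h y hy, meanAbove,
      mul_div_cancel₀ _ (hf.one_sub_cdf_mem hy).1.ne']
  -- the line of slope `b x` through the revenue curve at `x` is above the revenue curve
  have hinc : ∀ {y z}, 0 < f y → 0 < f z → y ≤ z →
      b y * (cdf (law f) z - cdf (law f) y) ≤
        (∫ u in Ioi y, b u ∂law f) - (∫ u in Ioi z, b u ∂law f) ∧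
      (∫ u in Ioi y, b u ∂law f) - (∫ u in Ioi z, b u ∂law f) ≤
        b z * (cdf (law f) z - cdf (law f) y) := by
    intro y z hy hz hyz
    rw [← Ioc_union_Ioi_eq_Ioi hyz, setIntegral_union (Ioc_disjoint_Ioi le_rfl) measurableSet_Ioi
      (hb.integrable hf).integrableOn (hb.integrable hf).integrableOn, add_sub_cancel_right,
      ← hf.real_Ioc hyz, mul_comm, ← smul_eq_mul, ← setIntegral_const, mul_comm, ← smul_eq_mul,
      ← setIntegral_const]
    constructor
    · refine setIntegral_mono_on_ae (integrable_const _).integrableOn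
        (hb.integrable hf).integrableOn measurableSet_Ioc ?_
      filter_upwards [hf.ae_pos] with u hu hyu
      exact (hb.strictMonoOn hy hu hyu.1).le
    · refine setIntegral_mono_on_ae (hb.integrable hf).integrableOn
        (integrable_const _).integrableOn measurableSet_Ioc ?_
      filter_upwards [hf.ae_pos] with u hu hyu
      exact hb.strictMonoOn.monotoneOn hu hz hyu.2
  -- The increments of the tail integral lie between those with the bids at the two endpoints, so
  -- the line of slope `b y` supports the revenue curve from above.
  have hline : ∀ {y}, 0 < f y → ∀ p ∈ Ioo (0 : ℝ) 1,
      leastConcaveMajorant R p ≤ R (1 - cdf (law f) y) + b y * (p - (1 - cdf (law f) y)) := by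
    intro y hy p hp
    have : ∀ p ∈ Ioo (0 : ℝ) 1,
        R p ≤ (R (1 - cdf (law f) y) - b y * (1 - cdf (law f) y)) + b y * p := by
      intro p hp
      obtain ⟨z, hz, rfl⟩ := hf.exists_one_sub_cdf_eq hp
      rw [hRB hy, hRB hz]
      rcases le_total y z with hyz | hyz
      · have := (hinc hy hz hyz).1; linarith
      · have := (hinc hz hy hyz).2; linarith
    have := leastConcaveMajorant_le_line this hp
    linarith
  have hq := hf.one_sub_cdf_mem hx
  rw [hg.ironedVirtualValue_reportLaw hf hx]
  refine le_antisymm ?_ ?_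
  · have hd := (hasDerivWithinAt_iff_tendsto_slope' self_notMem_Ioi).1
      (hasDerivWithinAt_leastConcaveMajorant hC hq)
    refine le_of_tendsto hd ?_
    filter_upwards [Ioo_mem_nhdsGT hq.2] with p hp
    have e1 := hline hx p ⟨hq.1.trans hp.1, hp.2⟩
    have e2 := le_leastConcaveMajorant hC hq
    rw [slope_def_field, div_le_iff₀ (sub_pos.2 hp.1)]
    linarith
  -- By continuity some `y < x` still has `b y` above the slope. Its supporting line at the quantile
  -- of `x` contradicts the tangent at that quantile.
  · by_contra! hcon
    obtain ⟨y, hyx, hy, hyb⟩ := hf.exists_lt_of_eventually hx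
      ((hb.continuousOn x hx).eventually (lt_mem_nhds hcon))
    have hqy := hf.one_sub_cdf_mem hy
    have e1 := hline hy _ hq
    have e2 := leastConcaveMajorant_le_tangent hC hq hqy
    have e3 := le_leastConcaveMajorant hC hqy
    have e4 := hf.strictMonoOn_cdf hy hx hyx
    have e5 := mul_lt_mul_of_pos_right hyb (sub_pos.2 e4)
    linarith

/-- The reports `meanAbove f b` are regular, with virtual value equal to the bid. -/
theorem isRegular_reportLaw_meanAbove (hf : IsValueDensity f) (hb : IsBid f b) :
    IsRegular (reportLaw f (meanAbove f b)) := by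
  have hg := isShading_meanAbove hf hb
  set g := meanAbove f b with hg_def
  have hg' : ∀ {x}, 0 < f x → 0 < f x / (1 - cdf (law f) x) * (g x - b x) := fun {x} hx =>
    mul_pos (div_pos hx (hf.one_sub_cdf_mem hx).1) (sub_pos.2 (lt_meanAbove hf hb hx))
  have hd : ∀ {x}, 0 < f x → HasDerivAt (cdf (reportLaw f g))
      (f x * (f x / (1 - cdf (law f) x) * (g x - b x))⁻¹) (g x) := by
    intro x hx
    set I : Set ℝ := {x | 0 < f x} with hI
    set i : ℝ → ℝ := Function.invFunOn g I with hi
    have hleft : ∀ u ∈ I, i (g u) = u := fun u hu => hg.strictMonoOn.injOn.leftInvOn_invFunOn hu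
    have himage : g '' I ∈ 𝓝 (g x) := by
      obtain ⟨y, hyx, hy⟩ := hf.exists_lt hx
      obtain ⟨z, hxz, hz⟩ := hf.exists_gt hx
      refine mem_of_superset (Icc_mem_nhds (hg.strictMonoOn hy hx hyx) (hg.strictMonoOn hx hz hxz))
        (hf.ordConnected_support.isPreconnected.intermediate_value hy hz hg.continuousOn)
    have hii : i '' (g '' I) = I := by
      rw [image_image]
      ext u
      constructor
      · rintro ⟨w, hw, rfl⟩
        change i (g w) ∈ I
        rwa [hleft w hw]
      · exact fun hu => ⟨u, hu, hleft u hu⟩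
    have hmono : StrictMonoOn i (g '' I) := by
      rintro _ ⟨u, hu, rfl⟩ _ ⟨w, hw, rfl⟩ huw
      rw [hleft u hu, hleft w hw]
      exact (hg.strictMonoOn.lt_iff_lt hu hw).1 huw
    -- A strictly increasing function whose image is a neighbourhood is continuous; this permits
    -- differentiating the inverse of `g`.
    have hcont : ContinuousAt i (g x) := by
      refine hmono.continuousAt_of_image_mem_nhds himage ?_
      rw [hii, hleft x hx]
      exact hf.isOpen_support.mem_nhds hx
    have hinv : HasDerivAt i (f x / (1 - cdf (law f) x) * (g x - b x))⁻¹ (g x) := by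
      refine HasDerivAt.of_local_left_inverse (f := g) hcont ?_ (hg' hx).ne' ?_
      · rw [hleft x hx]
        exact hasDerivAt_meanAbove hf hb hx
      · filter_upwards [himage]
        rintro _ ⟨u, hu, rfl⟩
        rw [hleft u hu]
    have hF : HasDerivAt (cdf (law f)) (f x) (i (g x)) := by
      rw [hleft x hx]
      exact hf.hasDerivAt_cdf hx
    refine (hF.comp (g x) hinv).congr_of_eventuallyEq ?_
    filter_upwards [himage]
    rintro _ ⟨u, hu, rfl⟩
    rw [hg.cdf_reportLaw_apply hf hu, Function.comp_apply, hleft u hu]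
  -- The report density at `g x` is `f x / g' x`, so the virtual value formula is the left side of
  -- the shading equation.
  have hvv : ∀ {x}, 0 < f x → virtualValue (reportLaw f g) (g x) = b x := by
    intro x hx
    rw [virtualValue, (hd hx).deriv, hg.cdf_reportLaw_apply hf hx]
    have h0 : 1 - cdf (law f) x ≠ 0 := (hf.one_sub_cdf_mem hx).1.ne'
    have h1 : g x - b x ≠ 0 := (sub_pos.2 (lt_meanAbove hf hb hx)).ne'
    field_simp [hx.ne']
    ring
  rw [IsRegular, hg.core_reportLaw hf]
  constructor
  · rintro _ ⟨x, hx, rfl⟩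
    rw [(hd hx).deriv]
    exact ⟨(hd hx).differentiableAt, mul_pos hx (inv_pos.2 (hg' hx))⟩
  · rintro _ ⟨x, hx, rfl⟩ _ ⟨y, hy, rfl⟩ hxy
    rw [hvv hx, hvv hy]
    exact hb.strictMonoOn hx hy ((hg.strictMonoOn.lt_iff_lt hx hy).1 hxy)

end IsBid

/-! ### Separating a bidder's value from those of the opponents -/

section Reduction

variable {f : ℝ → ℝ} {m : ℕ}

theorem IsValueDensity.isProbabilityMeasure_valuesLaw (hf : IsValueDensity f) (n : ℕ) :
    IsProbabilityMeasure (valuesLaw n f) := by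
  have := hf.isProbabilityMeasure
  unfold valuesLaw
  infer_instance

theorem IsValueDensity.measurePreserving_insertNth (hf : IsValueDensity f) (n : ℕ)
    (i : Fin (n + 1)) :
    MeasurePreserving (MeasurableEquiv.piFinSuccAbove (fun _ => ℝ) i).symm
      ((law f).prod (valuesLaw n f)) (valuesLaw (n + 1) f) := by
  have := hf.isProbabilityMeasure
  exact (measurePreserving_piFinSuccAbove (fun _ => law f) i).symm _

theorem IsValueDensity.integral_valuesLaw (hf : IsValueDensity f) {n : ℕ} (i : Fin (n + 1))
    (φ : (Fin (n + 1) → ℝ) → ℝ) : ∫ x, φ x ∂valuesLaw (n + 1) f =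
      ∫ p : ℝ × (Fin n → ℝ), φ (i.insertNth p.1 p.2) ∂(law f).prod (valuesLaw n f) :=
  ((hf.measurePreserving_insertNth n i).integral_comp' φ).symm

theorem IsValueDensity.integrable_valuesLaw_iff (hf : IsValueDensity f) {n : ℕ} (i : Fin (n + 1))
    {φ : (Fin (n + 1) → ℝ) → ℝ} : Integrable φ (valuesLaw (n + 1) f) ↔
      Integrable (fun p : ℝ × (Fin n → ℝ) => φ (i.insertNth p.1 p.2))
        ((law f).prod (valuesLaw n f)) :=
  ((hf.measurePreserving_insertNth n i).integrable_comp_emb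
    (MeasurableEquiv.measurableEmbedding _)).symm

theorem IsValueDensity.ae_pos_valuesLaw (hf : IsValueDensity f) (n : ℕ) :
    ∀ᵐ w ∂valuesLaw n f, ∀ j, 0 < f (w j) := by
  have := hf.isProbabilityMeasure
  exact ae_all_iff.2 fun j =>
    (Measure.tendsto_eval_ae_ae (μ := fun _ : Fin n => law f) (i := j)).eventually hf.ae_pos

theorem IsValueDensity.ae_pos_prod (hf : IsValueDensity f) (n : ℕ) :
    ∀ᵐ p ∂(law f).prod (valuesLaw n f), 0 < f p.1 ∧ ∀ j, 0 < f (p.2 j) := by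
  have := hf.isProbabilityMeasure
  have := hf.isProbabilityMeasure_valuesLaw n
  exact (Measure.quasiMeasurePreserving_fst.ae hf.ae_pos).and
    (Measure.quasiMeasurePreserving_snd.ae (hf.ae_pos_valuesLaw n))

theorem IsValueDensity.integral_valuesLaw_congr (hf : IsValueDensity f) {n : ℕ} (i : Fin (n + 1))
    {φ : (Fin (n + 1) → ℝ) → ℝ} {U : ℝ × (Fin n → ℝ) → ℝ}
    (h : ∀ x w, 0 < f x → (∀ j, 0 < f (w j)) → φ (i.insertNth x w) = U (x, w)) :
    ∫ x, φ x ∂valuesLaw (n + 1) f = ∫ p, U p ∂(law f).prod (valuesLaw n f) := by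
  rw [hf.integral_valuesLaw i]
  refine integral_congr_ae ?_
  filter_upwards [hf.ae_pos_prod n] with p hp
  exact h p.1 p.2 hp.1 hp.2

theorem maxValue_pos {w : Fin (m + 1) → ℝ} (hw : ∀ j, 0 < f (w j)) : 0 < f (maxValue w) := by
  obtain ⟨j, hj⟩ := exists_eq_maxValue w
  exact hj ▸ hw j

theorem IsBid.forall_le_iff {b : ℝ → ℝ} (hb : IsBid f b) {w : Fin (m + 1) → ℝ}
    (hw : ∀ j, 0 < f (w j)) {v : ℝ} : (∀ j, b (w j) ≤ v) ↔ b (maxValue w) ≤ v := by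
  constructor
  · intro h
    obtain ⟨j, hj⟩ := exists_eq_maxValue w
    exact hj ▸ h j
  · intro h j
    exact (hb.strictMonoOn.monotoneOn (hw j) (maxValue_pos hw) (le_maxValue w j)).trans h

theorem forall_ne_iff_forall_succAbove {n : ℕ} (i : Fin (n + 1)) {p : Fin (n + 1) → Prop} :
    (∀ j, j ≠ i → p j) ↔ ∀ k, p (i.succAbove k) := by
  constructor
  · exact fun h k => h _ (Fin.succAbove_ne i k)
  · intro h j hj
    obtain ⟨k, rfl⟩ := Fin.exists_succAbove_eq hj
    exact h k

end Reduction

/-! ### The first-price auction -/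

section FirstPrice

variable {f : ℝ → ℝ}

theorem IsValueDensity.isBid_meanBelow (hf : IsValueDensity f) (m : ℕ) :
    IsBid f (meanBelow (maxDensity m f)) := by
  have hh := hf.isValueDensity_maxDensity m
  have hs : {x | 0 < maxDensity m f x} = {x | 0 < f x} := by
    ext x; exact hf.maxDensity_pos_iff m
  exact ⟨hh.measurable_meanBelow, hh.meanBelow_nonneg,
    ⟨_, fun x hx => hh.meanBelow_le_mean ((hf.maxDensity_pos_iff m).2 hx)⟩,
    hs ▸ hh.continuousOn_meanBelow, hs ▸ hh.strictMonoOn_meanBelow⟩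

variable {m : ℕ} (i : Fin (m + 2))

theorem firstPriceUtility_insertNth {b c : ℝ → ℝ} (hb : IsBid f b) {x : ℝ} {w : Fin (m + 1) → ℝ}
    (hw : ∀ j, 0 < f (w j)) :
    firstPriceUtility (Function.update (fun _ => b) i c) i (i.insertNth x w) =
      {w | b (maxValue w) ≤ c x}.indicator (fun _ => x - c x) w := by
  unfold firstPriceUtility
  simp only [indicator, mem_ofPred_eq, forall_ne_iff_forall_succAbove i, Fin.insertNth_apply_same,
    Fin.insertNth_apply_succAbove, Function.update_self,
    Function.update_of_ne (Fin.succAbove_ne i _), hb.forall_le_iff hw]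

theorem integral_indicator_maxValue_le (hf : IsValueDensity f) {b : ℝ → ℝ} (hb : Measurable b)
    (r c : ℝ) :
    ∫ w, {w : Fin (m + 1) → ℝ | b (maxValue w) ≤ c}.indicator (fun _ => r) w ∂valuesLaw (m + 1) f =
      r * (law (maxDensity m f)).real {y | b y ≤ c} := by
  have hs : MeasurableSet {y | b y ≤ c} := hb measurableSet_Iic
  have hs' : MeasurableSet {w : Fin (m + 1) → ℝ | b (maxValue w) ≤ c} := measurable_maxValue hs
  rw [integral_indicator hs', setIntegral_const, smul_eq_mul, mul_comm]
  congr 1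
  exact (hf.measurePreserving_maxValue m).measureReal_preimage hs.nullMeasurableSet

theorem firstPricePayoff_update_le (hf : IsValueDensity f) (c : ℝ → ℝ) :
    firstPricePayoff f (Function.update (fun _ => meanBelow (maxDensity m f)) i c) i ≤
      ∫ x, expectedGain (maxDensity m f) x ∂law f := by
  have hb := hf.isBid_meanBelow m
  have hh := hf.isValueDensity_maxDensity m
  have := hf.isProbabilityMeasure
  have := hf.isProbabilityMeasure_valuesLaw (m + 1)
  set U : ℝ × (Fin (m + 1) → ℝ) → ℝ := fun p =>
    {w | meanBelow (maxDensity m f) (maxValue w) ≤ c p.1}.indicator (fun _ => p.1 - c p.1) p.2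
    with hU
  rw [firstPricePayoff, hf.integral_valuesLaw_congr i (U := U)
    fun x w _ hw => firstPriceUtility_insertNth i hb hw]
  by_cases hi : Integrable U ((law f).prod (valuesLaw (m + 1) f))
  · rw [integral_prod _ hi]
    refine integral_mono hi.integral_prod_left (hh.integrable_expectedGain hf) fun x => ?_
    simp only [hU, integral_indicator_maxValue_le hf hb.measurable]
    exact hh.sub_mul_le_expectedGain x (c x)
  -- A nonintegrable deviation has payoff `0` by convention, still below the nonnegative bound.
  · rw [integral_undef hi]
    exact integral_nonneg fun x => IsValueDensity.expectedGain_nonneg x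

/-- The utility of a bidder with value `x` whose strongest opponent has value `y`, if everyone
bids `b`. -/
noncomputable def duelUtility (b : ℝ → ℝ) (x y : ℝ) : ℝ :=
  {y | b y ≤ b x}.indicator (fun _ => x - b x) y

theorem firstPriceUtility_ae_eq (hf : IsValueDensity f) {b : ℝ → ℝ} (hb : IsBid f b) :
    (fun p : ℝ × (Fin (m + 1) → ℝ) =>
      firstPriceUtility (fun _ : Fin (m + 2) => b) i (i.insertNth p.1 p.2))
      =ᵐ[(law f).prod (valuesLaw (m + 1) f)] fun p => duelUtility b p.1 (maxValue p.2) := by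
  filter_upwards [hf.ae_pos_prod (m + 1)] with p hp
  have := firstPriceUtility_insertNth i hb (c := b) (x := p.1) hp.2
  rwa [Function.update_eq_self_iff.2 rfl] at this

theorem integrable_duelUtility (hf : IsValueDensity f) {b : ℝ → ℝ} (hb : IsBid f b) :
    Integrable (fun p : ℝ × (Fin (m + 1) → ℝ) => duelUtility b p.1 (maxValue p.2))
      ((law f).prod (valuesLaw (m + 1) f)) := by
  have := hf.isProbabilityMeasure
  have := hf.isProbabilityMeasure_valuesLaw (m + 1)
  have h1 : Integrable (fun p : ℝ × (Fin (m + 1) → ℝ) => p.1 - b p.1)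
      ((law f).prod (valuesLaw (m + 1) f)) :=
    (hf.integrable_id_law.sub (hb.integrable hf)).comp_fst _
  exact h1.indicator (measurableSet_le
    (hb.measurable.comp (measurable_maxValue.comp measurable_snd))
    (hb.measurable.comp measurable_fst))

theorem integrable_firstPriceUtility (hf : IsValueDensity f) {b : ℝ → ℝ} (hb : IsBid f b) :
    Integrable (firstPriceUtility (fun _ : Fin (m + 2) => b) i) (valuesLaw (m + 2) f) := by
  rw [hf.integrable_valuesLaw_iff i]
  exact (integrable_duelUtility hf hb).congr (firstPriceUtility_ae_eq i hf hb).symm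

theorem firstPricePayoff_eq_integral_duelUtility (hf : IsValueDensity f) {b : ℝ → ℝ}
    (hb : IsBid f b) : firstPricePayoff f (fun _ : Fin (m + 2) => b) i =
      ∫ p, duelUtility b p.1 (maxValue p.2) ∂(law f).prod (valuesLaw (m + 1) f) := by
  rw [firstPricePayoff, hf.integral_valuesLaw i]
  exact integral_congr_ae (firstPriceUtility_ae_eq i hf hb)

theorem firstPricePayoff_eq (hf : IsValueDensity f) :
    firstPricePayoff f (fun _ : Fin (m + 2) => meanBelow (maxDensity m f)) i =
      ∫ x, expectedGain (maxDensity m f) x ∂law f := by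
  have hb := hf.isBid_meanBelow m
  have hh := hf.isValueDensity_maxDensity m
  have := hf.isProbabilityMeasure
  have := hf.isProbabilityMeasure_valuesLaw (m + 1)
  rw [firstPricePayoff_eq_integral_duelUtility i hf hb,
    integral_prod _ (integrable_duelUtility hf hb)]
  refine integral_congr_ae ?_
  filter_upwards [hf.ae_pos] with x hx
  exact (integral_indicator_maxValue_le hf hb.measurable _ _).trans
    (hh.sub_meanBelow_mul ((hf.maxDensity_pos_iff m).2 hx))

end FirstPrice

/-! ### The Myerson auction -/

section Myerson

open IsShading

variable {f b g γ : ℝ → ℝ} {m : ℕ} (i : Fin (m + 2))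

theorem myersonUtility_insertNth (hf : IsValueDensity f) (hb : IsBid f b)
    (hg : ∀ x, 0 < f x → ironedVirtualValue (reportLaw f g) (g x) = b x) (hγ : IsShading f γ)
    {x : ℝ} (hx : 0 < f x) {w : Fin (m + 1) → ℝ} (hw : ∀ j, 0 < f (w j)) :
    myersonUtility f (Function.update (fun _ => g) i γ) i (i.insertNth x w) =
      (winSet f γ (b (maxValue w))).indicator
        (fun x => x - winPrice f γ (b (maxValue w))) x := by
  have hbeats : ∀ v, Beats (fun j => reportLaw f (Function.update (fun _ => g) i γ j))
      (fun j => Function.update (fun _ => g) i γ j (i.insertNth (α := fun _ => ℝ) x w j)) i v ↔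
        b (maxValue w) ≤ v := by
    intro v
    rw [Beats, forall_ne_iff_forall_succAbove i, ← hb.forall_le_iff hw]
    simp only [Fin.insertNth_apply_succAbove, Function.update_of_ne (Fin.succAbove_ne i _),
      hg _ (hw _)]
    -- There is at least one opponent, and its virtual value is a nonnegative bid, so beating it
    -- already meets the reserve.
    exact ⟨fun h => h.2, fun h => ⟨(hb.nonneg _).trans (h 0), h⟩⟩
  have hprice : myersonPrice (fun j => reportLaw f (Function.update (fun _ => g) i γ j))
      (fun j => Function.update (fun _ => g) i γ j (i.insertNth (α := fun _ => ℝ) x w j)) i =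
        winPrice f γ (b (maxValue w)) := by
    rw [myersonPrice, winPrice]
    congr 1
    ext y
    simp only [mem_ofPred_eq, hbeats, Function.update_self, hγ.core_reportLaw hf]
    constructor
    · rintro ⟨⟨u, hu, rfl⟩, h⟩
      exact ⟨u, ⟨hu, h⟩, rfl⟩
    · rintro ⟨u, hu, rfl⟩
      exact ⟨⟨u, hu.1, rfl⟩, hu.2⟩
  unfold myersonUtility
  simp only [indicator, mem_ofPred_eq, hbeats, hprice, Function.update_self,
    Fin.insertNth_apply_same, winSet, hx, true_and]

/-- The payoff of a deviation is at most that of bidding its ironed virtual value in the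
first-price auction. -/
theorem myersonPayoff_update_le (hf : IsValueDensity f)
    (hg : ∀ x, 0 < f x →
      ironedVirtualValue (reportLaw f g) (g x) = meanBelow (maxDensity m f) x)
    (hγ : IsShading f γ) :
    myersonPayoff f (Function.update (fun _ => g) i γ) i ≤
      ∫ x, expectedGain (maxDensity m f) x ∂law f := by
  have hb := hf.isBid_meanBelow m
  have hh := hf.isValueDensity_maxDensity m
  have := hf.isProbabilityMeasure
  have := hh.isProbabilityMeasure
  have := hf.isProbabilityMeasure_valuesLaw (m + 1)
  set b := meanBelow (maxDensity m f) with hb_def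
  set ψ : ℝ → ℝ := fun x => ironedVirtualValue (reportLaw f γ) (γ x) with hψ
  set U : ℝ × (Fin (m + 1) → ℝ) → ℝ := fun p =>
    (winSet f γ (b (maxValue p.2))).indicator
      (fun x => x - winPrice f γ (b (maxValue p.2))) p.1 with hU
  rw [myersonPayoff, hf.integral_valuesLaw_congr i (U := U)
    fun x w hx hw => myersonUtility_insertNth i hf hb hg hγ hx hw]
  by_cases hi : Integrable U ((law f).prod (valuesLaw (m + 1) f))
  swap
  · rw [integral_undef hi]
    exact integral_nonneg fun x => IsValueDensity.expectedGain_nonneg x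
  have hmeasT : ∀ v, MeasurableSet (winSet f γ v) := fun v =>
    (ordConnected_winSet hf hγ v).measurableSet
  have hψT : ∀ y, IntegrableOn ψ (winSet f γ (b y)) (law f) := fun y =>
    (integrableOn_winSet_and_le hf hγ (hb.nonneg y)).1
  -- the utility with the ironed virtual value as payment
  set Φ : ℝ × ℝ → ℝ := fun p => (winSet f γ (b p.2)).indicator (fun x => x - ψ x) p.1 with hΦ
  have hΦx : ∀ y, Integrable (fun x => Φ (x, y)) (law f) := fun y =>
    (integrable_indicator_iff (hmeasT _)).2 (hf.integrable_id_law.integrableOn.sub (hψT y))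
  have hψm : AEMeasurable (fun p : ℝ × ℝ => ψ p.1) ((law f).prod (law (maxDensity m f))) :=
    (aemeasurable_ironedVirtualValue hf hγ).comp_quasiMeasurePreserving
      Measure.quasiMeasurePreserving_fst
  have hΦm : AEStronglyMeasurable Φ ((law f).prod (law (maxDensity m f))) := by
    have h1 : AEStronglyMeasurable (fun p : ℝ × ℝ => p.1 - ψ p.1)
        ((law f).prod (law (maxDensity m f))) :=
      (measurable_fst.aemeasurable.sub hψm).aestronglyMeasurable
    have h2 : NullMeasurableSet {p : ℝ × ℝ | 0 < f p.1 ∧ b p.2 ≤ ψ p.1}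
        ((law f).prod (law (maxDensity m f))) :=
      ((measurable_fst hf.measurableSet_support).nullMeasurableSet).inter
        (nullMeasurableSet_le (hb.measurable.comp measurable_snd).aemeasurable hψm)
    exact h1.indicator₀ h2
  -- `|Φ|` is at most `|x|` plus `ψ` on the win set, and the integral of the latter is at most the
  -- mean report, uniformly in `y`.
  have hΦi : Integrable Φ ((law f).prod (law (maxDensity m f))) := by
    rw [integrable_prod_iff' hΦm]
    refine ⟨ae_of_all _ hΦx, Integrable.of_bound hΦm.norm.prod_swap.integral_prod_right'
      ((∫ x, |x| ∂law f) + ∫ x, γ x ∂law f) (ae_of_all _ fun y => ?_)⟩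
    rw [Real.norm_of_nonneg (integral_nonneg fun x => norm_nonneg _)]
    have e1 : ∀ x, ‖Φ (x, y)‖ ≤ |x| + (winSet f γ (b y)).indicator ψ x := by
      intro x
      by_cases hx : x ∈ winSet f γ (b y)
      · simp only [hΦ, indicator_of_mem hx, Real.norm_eq_abs]
        refine (abs_sub _ _).trans_eq ?_
        rw [abs_of_nonneg ((hb.nonneg y).trans hx.2)]
      · simp [hΦ, indicator_of_notMem hx]
    have e2 : Integrable ((winSet f γ (b y)).indicator ψ) (law f) :=
      (integrable_indicator_iff (hmeasT _)).2 (hψT y)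
    refine (integral_mono (hΦx y).norm (hf.integrable_id_law.abs.add e2) e1).trans ?_
    simp only [Pi.add_apply]
    rw [integral_add hf.integrable_id_law.abs e2, integral_indicator (hmeasT _)]
    exact add_le_add_right ((integrableOn_winSet_and_le hf hγ (hb.nonneg y)).2.trans
      (winPrice_mul_le hf hγ _)) _
  -- for given opponents, the payment is at least the integral of the ironed virtual value
  have hstep : ∀ w : Fin (m + 1) → ℝ, ∫ x, (winSet f γ (b (maxValue w))).indicator
      (fun x => x - winPrice f γ (b (maxValue w))) x ∂law f ≤ ∫ x, Φ (x, maxValue w) ∂law f := by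
    intro w
    have e1 := (integrableOn_winSet_and_le hf hγ (hb.nonneg (maxValue w))).2
    simp only [hΦ]
    rw [integral_indicator (hmeasT _), integral_indicator (hmeasT _),
      integral_sub hf.integrable_id_law.integrableOn (integrable_const _).integrableOn,
      integral_sub hf.integrable_id_law.integrableOn (hψT _), setIntegral_const, smul_eq_mul]
    linarith
  have hmp := hf.measurePreserving_maxValue m
  have hk : Integrable (fun y => ∫ x, Φ (x, y) ∂law f) (law (maxDensity m f)) :=
    hΦi.integral_prod_right
  rw [integral_prod_symm _ hi]
  calc ∫ w, ∫ x, (winSet f γ (b (maxValue w))).indicator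
          (fun x => x - winPrice f γ (b (maxValue w))) x ∂law f ∂valuesLaw (m + 1) f
      ≤ ∫ w, ∫ x, Φ (x, maxValue w) ∂law f ∂valuesLaw (m + 1) f :=
        integral_mono hi.integral_prod_right (hmp.integrable_comp_of_integrable hk) hstep
    _ = ∫ y, ∫ x, Φ (x, y) ∂law f ∂law (maxDensity m f) := by
        rw [← hmp.map_eq, integral_map measurable_maxValue.aemeasurable]
        rw [hmp.map_eq]
        exact hk.aestronglyMeasurable
    _ = ∫ x, ∫ y, Φ (x, y) ∂law (maxDensity m f) ∂law f :=
        (integral_integral_swap (f := fun x y => Φ (x, y)) hΦi).symm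
    -- For a fixed own value, what remains is the first-price payoff from bidding `ψ x`.
    _ ≤ ∫ x, expectedGain (maxDensity m f) x ∂law f := by
        refine integral_mono_ae hΦi.integral_prod_left (hh.integrable_expectedGain hf) ?_
        filter_upwards [hf.ae_pos] with x hx
        have e1 : (fun y => Φ (x, y)) = {y | b y ≤ ψ x}.indicator fun _ => x - ψ x := by
          funext y
          simp only [hΦ, indicator, winSet, mem_ofPred_eq, hx, true_and]
          rfl
        have e2 : MeasurableSet {y | b y ≤ ψ x} := hb.measurable measurableSet_Iic
        rw [e1, integral_indicator e2, setIntegral_const,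
          smul_eq_mul, mul_comm]
        exact hh.sub_mul_le_expectedGain x (ψ x)

theorem winSet_eq (hb : IsBid f b)
    (hg : ∀ x, 0 < f x → ironedVirtualValue (reportLaw f g) (g x) = b x) {x y : ℝ}
    (hx : 0 < f x) (hy : 0 < f y) : x ∈ winSet f g (b y) ↔ y ≤ x := by
  rw [winSet, mem_ofPred_eq, hg x hx, hb.strictMonoOn.le_iff_le hy hx]
  exact and_iff_right hx

theorem winPrice_eq (hb : IsBid f b) (hgs : IsShading f g)
    (hg : ∀ x, 0 < f x → ironedVirtualValue (reportLaw f g) (g x) = b x) {y : ℝ}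
    (hy : 0 < f y) : winPrice f g (b y) = g y := by
  refine IsLeast.csInf_eq ⟨mem_image_of_mem g ((winSet_eq hb hg hy hy).2 le_rfl), ?_⟩
  rintro _ ⟨x, hx, rfl⟩
  exact hgs.strictMonoOn.monotoneOn hy hx.1 ((winSet_eq hb hg hx.1 hy).1 hx)

/-- The utility of a bidder with value `x` whose strongest opponent has value `y`, if everyone
shades by `meanAbove f b`. -/
noncomputable def shadingDuelUtility (f b : ℝ → ℝ) (x y : ℝ) : ℝ :=
  (Ici y).indicator (fun x => x - meanAbove f b y) x

theorem myersonUtility_ae_eq (hf : IsValueDensity f) (hb : IsBid f b) (hgs : IsShading f g)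
    (hg : ∀ x, 0 < f x → g x = meanAbove f b x) :
    (fun p : ℝ × (Fin (m + 1) → ℝ) =>
      myersonUtility f (fun _ : Fin (m + 2) => g) i (i.insertNth p.1 p.2))
      =ᵐ[(law f).prod (valuesLaw (m + 1) f)]
        fun p => shadingDuelUtility f b p.1 (maxValue p.2) := by
  have hgv : ∀ x, 0 < f x → ironedVirtualValue (reportLaw f g) (g x) = b x :=
    fun x hx => hb.ironedVirtualValue_eq hf hgs hg hx
  filter_upwards [hf.ae_pos_prod (m + 1)] with p hp
  have h := myersonUtility_insertNth i hf hb hgv hgs hp.1 hp.2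
  have hy := maxValue_pos hp.2
  rw [Function.update_eq_self_iff.2 rfl, winPrice_eq hb hgs hgv hy, hg _ hy] at h
  rw [h, shadingDuelUtility]
  simp only [indicator, winSet_eq hb hgv hp.1 hy, mem_Ici]

theorem integrable_shadingDuelUtility (hf : IsValueDensity f) (hb : IsBid f b) :
    Integrable (fun p : ℝ × (Fin (m + 1) → ℝ) => shadingDuelUtility f b p.1 (maxValue p.2))
      ((law f).prod (valuesLaw (m + 1) f)) := by
  have := hf.isProbabilityMeasure
  have := hf.isProbabilityMeasure_valuesLaw (m + 1)
  obtain ⟨C, hC⟩ := hb.bounded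
  have hm : Measurable fun p : ℝ × (Fin (m + 1) → ℝ) => meanAbove f b (maxValue p.2) :=
    (hb.measurable_meanAbove hf).comp (measurable_maxValue.comp measurable_snd)
  have h1 : Integrable (fun p : ℝ × (Fin (m + 1) → ℝ) => meanAbove f b (maxValue p.2))
      ((law f).prod (valuesLaw (m + 1) f)) := by
    refine Integrable.of_bound hm.aestronglyMeasurable C ?_
    filter_upwards [hf.ae_pos_prod (m + 1)] with p hp
    have hy := maxValue_pos hp.2
    rw [Real.norm_of_nonneg ((hb.isShading_meanAbove hf).nonneg _ hy)]
    exact hb.meanAbove_le hf hC hy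
  exact ((hf.integrable_id_law.comp_fst _).sub h1).indicator
    (measurableSet_le (measurable_maxValue.comp measurable_snd) measurable_fst)

/-- Multiplying `meanAbove f b y` by `P(X ≥ y)` returns the integral of `b` over `X ≥ y`. The two
auctions thus agree conditionally on the strongest opponent, which is why payoffs are compared with
the opponents in the outer integral. -/
theorem integral_shadingDuelUtility (hf : IsValueDensity f) (hb : IsBid f b) {y : ℝ}
    (hy : 0 < f y) :
    ∫ x, shadingDuelUtility f b x y ∂law f = ∫ x, duelUtility b x y ∂law f := by
  have := hf.isProbabilityMeasure
  have h1 : (fun x => duelUtility b x y) =ᵐ[law f] (Ici y).indicator fun x => x - b x := by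
    filter_upwards [hf.ae_pos] with x hx
    simp only [duelUtility, indicator, mem_ofPred_eq, hb.strictMonoOn.le_iff_le hy hx, mem_Ici]
  rw [integral_congr_ae h1]
  simp only [shadingDuelUtility]
  rw [integral_indicator measurableSet_Ici, integral_indicator measurableSet_Ici,
    integral_sub hf.integrable_id_law.integrableOn (integrable_const _).integrableOn,
    integral_sub hf.integrable_id_law.integrableOn (hb.integrable hf).integrableOn,
    setIntegral_const, ← hf.one_sub_cdf, smul_eq_mul, meanAbove,
    mul_div_cancel₀ _ (hf.one_sub_cdf_mem hy).1.ne', integral_Ici_eq_integral_Ioi (f := b)]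

theorem integrable_myersonUtility (hf : IsValueDensity f) (hb : IsBid f b) (hgs : IsShading f g)
    (hg : ∀ x, 0 < f x → g x = meanAbove f b x) :
    Integrable (myersonUtility f (fun _ : Fin (m + 2) => g) i) (valuesLaw (m + 2) f) := by
  rw [hf.integrable_valuesLaw_iff i]
  exact (integrable_shadingDuelUtility hf hb).congr (myersonUtility_ae_eq i hf hb hgs hg).symm

theorem myersonPayoff_eq_firstPricePayoff (hf : IsValueDensity f) (hb : IsBid f b)
    (hgs : IsShading f g) (hg : ∀ x, 0 < f x → g x = meanAbove f b x) :
    myersonPayoff f (fun _ : Fin (m + 2) => g) i =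
      firstPricePayoff f (fun _ : Fin (m + 2) => b) i := by
  have := hf.isProbabilityMeasure
  have := hf.isProbabilityMeasure_valuesLaw (m + 1)
  rw [myersonPayoff, hf.integral_valuesLaw i, integral_congr_ae (myersonUtility_ae_eq i hf hb hgs hg),
    firstPricePayoff_eq_integral_duelUtility i hf hb,
    integral_prod_symm _ (integrable_shadingDuelUtility hf hb),
    integral_prod_symm _ (integrable_duelUtility hf hb)]
  refine integral_congr_ae ?_
  filter_upwards [hf.ae_pos_valuesLaw (m + 1)] with w hw
  exact integral_shadingDuelUtility hf hb (maxValue_pos hw)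

end Myerson

theorem equilibriumShading_eq_meanAbove {f : ℝ → ℝ} (hf : IsValueDensity f) (K : ℕ) :
    equilibriumShading K f = meanAbove f (firstPriceBid K f) := by
  have := hf.isProbabilityMeasure
  funext x
  rw [equilibriumShading, ProbabilityTheory.cond, integral_smul_measure, meanAbove, hf.one_sub_cdf,
    ENNReal.toReal_inv, smul_eq_mul, inv_mul_eq_div, integral_Ici_eq_integral_Ioi]
  rfl

end Auction

theorem mainTheorem1 (K : ℕ) (hK : 2 ≤ K) (f : ℝ → ℝ) (hf : Auction.IsValueDensity f) :
    -- `β` is the bid in a symmetric equilibrium of the first-price auction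
    ((∀ i, Integrable (Auction.firstPriceUtility (fun _ : Fin K => Auction.firstPriceBid K f) i)
        (Auction.valuesLaw K f)) ∧
      Auction.IsFirstPriceEquilibrium f (fun _ : Fin K => Auction.firstPriceBid K f)) ∧
    -- shading by a solution of the equation is a symmetric equilibrium of the Myerson auction,
    -- with the payoff of the first-price auction
    (∀ g : ℝ → ℝ, Auction.IsShading f g → Auction.SolvesShadingEquation K f g →
      Auction.IsMyersonEquilibrium f (fun _ : Fin K => g) ∧
      ∀ i, Integrable (Auction.myersonUtility f (fun _ : Fin K => g) i) (Auction.valuesLaw K f) ∧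
        Auction.myersonPayoff f (fun _ : Fin K => g) i =
          Auction.firstPricePayoff f (fun _ : Fin K => Auction.firstPriceBid K f) i) ∧
    -- `E[β(X) | X ≥ x]` is an increasing solution, and the reports it leads to are regular
    (Auction.IsShading f (Auction.equilibriumShading K f) ∧
      Auction.SolvesShadingEquation K f (Auction.equilibriumShading K f) ∧
      StrictMonoOn (Auction.equilibriumShading K f) {x | 0 < f x} ∧
      Auction.IsRegular (Auction.reportLaw f (Auction.equilibriumShading K f))) := by
  -- With `K = m + 2` the truncated subtractions `K - 1` and `K - 2` become `m + 1` and `m`.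
  obtain ⟨m, rfl⟩ := Nat.exists_eq_add_of_le' hK
  rw [Auction.equilibriumShading_eq_meanAbove hf]
  unfold Auction.SolvesShadingEquation
  rw [Auction.firstPriceBid_eq_meanBelow hf m]
  have hb := hf.isBid_meanBelow m
  refine ⟨⟨fun i => Auction.integrable_firstPriceUtility i hf hb, fun i c _ => ?_⟩,
    fun g hg hsol => ?_, hb.isShading_meanAbove hf, fun x hx => hb.meanAbove_solves hf hx,
    hb.strictMonoOn_meanAbove hf, hb.isRegular_reportLaw_meanAbove hf⟩
  · rw [Auction.firstPricePayoff_eq i hf]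
    exact Auction.firstPricePayoff_update_le i hf c
  · have hgm := fun x (hx : 0 < f x) => hb.eq_meanAbove_of_solves hf hg hsol hx
    have hpay := fun i : Fin (m + 2) =>
      Auction.myersonPayoff_eq_firstPricePayoff i hf hb hg hgm
    refine ⟨fun i => ⟨hg, fun γ hγ => ?_⟩, fun i =>
      ⟨Auction.integrable_myersonUtility i hf hb hg hgm, hpay i⟩⟩
    rw [hpay i, Auction.firstPricePayoff_eq i hf]
    exact Auction.myersonPayoff_update_le i hf
      (fun x hx => hb.ironedVirtualValue_eq hf hg hgm hx) hγ
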